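/- Let $\Delta$ be a simplicial polytopal fan in $\mathbb{R}^d$, i.e. $\Delta=\mathcal N(P_0)$ is the normal fan of a polytope $P_0$ and every cone of $\Delta$ is generated by linearly independent vectors; let $\mathbf v_1,\dots,\mathbf v_n$ be generators of the rays (one-dimensional cones) of $\Delta$, one for each ray. Let $\mathcal P(\Delta)$ be the set of all non-empty polytopes $Q\subset\mathbb R^d$ whose normal fan coarsens $\Delta$ (every cone of $\mathcal N(Q)$ is a union of cones of $\Delta$), and let $h_Q(\mathbf u)=\max_{\mathbf x\in Q}\langle \mathbf x,\mathbf u\rangle$ be the support function. For $\mathbf u\in\mathbb R^d$ let $[\mathbf u]\in\mathbb R^n$ be the vector with $\mathbf u=\sum_{i\in I}[\mathbf u]_i\mathbf v_i$ and $[\mathbf u]_i=0$ for $i\notin I$, where $\operatorname{pos}\{\mathbf v_i: i\in I\}$ is the cone of $\Delta$ whose relative interior contains $\mathbf u$. Put $c=\max_{\|\mathbf u\|=1}\max_{i}[\mathbf u]_i$ and, for $t\ge 0$ and $1\le j\le n$, $$C_t(j)=\{\mathbf x\in\mathbb R^d:\ |[\mathbf x]_j\|\mathbf v_j\|-1|\le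 t \text{ and } |[\mathbf x]_i\|\mathbf v_i\||\le t \text{ for all } i\ne j\}.$$ For directions $\mathbf u^{(1)},\dots,\mathbf u^{(m)}$ and $\mathbf y\in\mathbb R^m$, a least-squares estimate is a minimizer of $\frac1m\sum_{i=1}^m(h_Q(\mathbf u^{(i)})-y^{(i)})^2$ over $Q\in\mathcal P(\Delta)$. **Theorem.** Let $\mathbf u^{(1)},\mathbf u^{(2)},\dots$ be unit vectors in $\mathbb R^d$ for which there are $0\le t<1/2$, $\delta>0$ and an integer $N\ge1$ such that $$|\{\ell\in\{1,\dots,m\}:\ \mathbf u^{(\ell)}\in C_t(i)\}|\ \ge\ m\,(2.5\,nt+\delta)\qquad\text{for all } m\ge N,\ 1\le i\le n.$$ Let $P\in\mathcal P(\Delta)$ and $y^{(i)}=h_P(\mathbf u^{(i)})+\varepsilon^{(i)}$, $i\ge 1$, where the errors $\varepsilon^{(i)}\sim\mathcal N(0,\sigma_i^2)$ are independent and $\sigma_i^2\le\gamma$ for all $i$, with $0<\gamma<\infty$. Then for all $m\ge N$ and every data vector $\mathbf y\in\mathbb R^m$ there is exactly one least-squares estimate in $\mathcal P(\Delta)$.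 Denote by $\hat P_m$ the estimate obtained from the data $(\mathbf u^{(i)},y^{(i)})$, $i\le m$. Then, with $d_H$ the Hausdorff distance, $$\mathbb P\big(\lim_{m\to\infty}d_H(\hat P_m,P)=0\big)=1 ,$$ and for all $m\ge N$ and all $0<\eta\le1$ $$\mathbb P\left(d_H(\hat P_m,P)\ \ge\ \frac1{\sqrt m}\,\frac{n c^2}{\kappa}\sqrt{2d\gamma\lambda\log\Big(\frac{2n}{\eta}\Big)}\right)\le\eta ,$$ where $$\kappa=\Big(\frac{\delta}{\max_i\|\mathbf v_i\|^2}\Big)^{3/2},\qquad \lambda=c^2-\Big(c^2-\frac{t^2}{\min_i\|\mathbf v_i\|^2}\Big)(n-1)(2.5\,nt+\delta).$$ -/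

import Mathlib

open MeasureTheory ProbabilityTheory Filter Topology

namespace SupportReconstruction

variable {d n : ℕ}

/-- A polyhedron: an intersection of finitely many closed halfspaces of `ℝ^d`. -/
def IsPolyhedron (P : Set (EuclideanSpace ℝ (Fin d))) : Prop :=
  ∃ (k : ℕ) (a : Fin k → EuclideanSpace ℝ (Fin d)) (b : Fin k → ℝ),
    P = {x | ∀ i, inner ℝ (a i) x ≤ b i}

/-- A (non-empty) polytope: a non-empty bounded polyhedron. -/
structure IsPolytope (P : Set (EuclideanSpace ℝ (Fin d))) : Prop where
  nonempty : P.Nonempty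
  isPolyhedron : IsPolyhedron P
  isBounded : Bornology.IsBounded P

/-- The support function `h_P(u) = max_{x ∈ P} ⟨x, u⟩`; for a non-empty polytope the supremum
is attained. -/
noncomputable def supportFun (P : Set (EuclideanSpace ℝ (Fin d)))
    (u : EuclideanSpace ℝ (Fin d)) : ℝ :=
  sSup ((fun x => inner ℝ x u) '' P)

/-- The normal cone of `P` at the face `F`: all `x` such that every `p ∈ F` maximizes
`⟨x, ·⟩` over `P`. -/
def normalCone (P F : Set (EuclideanSpace ℝ (Fin d))) : Set (EuclideanSpace ℝ (Fin d)) :=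
  {x | ∀ p ∈ F, ∀ y ∈ P, inner ℝ x y ≤ inner ℝ x p}

/-- The normal fan of `P`: the normal cones at all non-empty faces of `P`. The non-empty faces
are the sets of maximizers of linear functionals (`P` itself arises from the zero functional). -/
def normalFan (P : Set (EuclideanSpace ℝ (Fin d))) : Set (Set (EuclideanSpace ℝ (Fin d))) :=
  {σ | ∃ F : Set (EuclideanSpace ℝ (Fin d)), F.Nonempty ∧ IsExposed ℝ P F ∧ σ = normalCone P F}

/-- The cone `pos{w_i}` of non-negative combinations of a finite family. -/
def posHull {ι : Type*} [Fintype ι] (w : ι → EuclideanSpace ℝ (Fin d)) :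
    Set (EuclideanSpace ℝ (Fin d)) :=
  {x | ∃ c : ι → ℝ, (∀ i, 0 ≤ c i) ∧ x = ∑ i, c i • w i}

/-- `Δ` is a simplicial polytopal fan, and `v_1, …, v_n` are generators of its rays, one for
each ray. -/
structure IsSimplicialPolytopalFan (Δ : Set (Set (EuclideanSpace ℝ (Fin d))))
    (v : Fin n → EuclideanSpace ℝ (Fin d)) : Prop where
  /-- `Δ` is the normal fan of a polytope. -/
  polytopal : ∃ P, IsPolytope P ∧ normalFan P = Δ
  /-- `i ↦ pos{v_i}` is a bijection onto the one-dimensional cones of `Δ`. -/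
  rays : Set.BijOn (fun i => posHull ![v i]) Set.univ
    {σ | σ ∈ Δ ∧ Module.finrank ℝ (Submodule.span ℝ σ) = 1}
  /-- Every cone of `Δ` is generated by linearly independent ray generators. -/
  simplicial : ∀ σ ∈ Δ, ∃ I : Finset (Fin n),
    LinearIndependent ℝ (fun i : I => v i) ∧ σ = posHull (fun i : I => v i)

/-- `Δ'` coarsens `Δ`: every cone of `Δ'` is a union of cones of `Δ`. -/
def Coarsens (Δ' Δ : Set (Set (EuclideanSpace ℝ (Fin d)))) : Prop :=
  ∀ σ ∈ Δ', ∃ S : Set (Set (EuclideanSpace ℝ (Fin d))), S ⊆ Δ ∧ σ = ⋃₀ S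

/-- The deformation cone `𝒫(Δ)`: all non-empty polytopes whose normal fan coarsens `Δ`. -/
def deformationCone (Δ : Set (Set (EuclideanSpace ℝ (Fin d)))) :
    Set (Set (EuclideanSpace ℝ (Fin d))) :=
  {Q | IsPolytope Q ∧ Coarsens (normalFan Q) Δ}

/-- `c` is the coordinate vector of `x`: if `σ = pos{v_i : i ∈ I}` is the cone of `Δ` with `x` in
its relative interior, then `x = ∑_{i ∈ I} c_i v_i` and `c_i = 0` for `i ∉ I`. -/
def IsFanCoord (Δ : Set (Set (EuclideanSpace ℝ (Fin d)))) (v : Fin n → EuclideanSpace ℝ (Fin d))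
    (x : EuclideanSpace ℝ (Fin d)) (c : Fin n → ℝ) : Prop :=
  ∃ σ ∈ Δ, x ∈ intrinsicInterior ℝ σ ∧ ∃ I : Finset (Fin n),
    LinearIndependent ℝ (fun i : I => v i) ∧ σ = posHull (fun i : I => v i) ∧
    (∀ i ∉ I, c i = 0) ∧ x = ∑ i ∈ I, c i • v i

open Classical in
/-- The vector `[x]^Δ ∈ ℝ^n`. -/
noncomputable def fanCoord (Δ : Set (Set (EuclideanSpace ℝ (Fin d))))
    (v : Fin n → EuclideanSpace ℝ (Fin d)) (x : EuclideanSpace ℝ (Fin d)) : Fin n → ℝ :=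
  if h : ∃ c, IsFanCoord Δ v x c then h.choose else 0

/-- `c^Δ = max_{‖u‖ = 1} max_i [u]_i`. -/
noncomputable def fanConst (Δ : Set (Set (EuclideanSpace ℝ (Fin d))))
    (v : Fin n → EuclideanSpace ℝ (Fin d)) : ℝ :=
  sSup {r | ∃ (u : EuclideanSpace ℝ (Fin d)) (i : Fin n), ‖u‖ = 1 ∧ r = fanCoord Δ v u i}

/-- The neighbourhood `C_t(j)` of `v_j / ‖v_j‖`: all `x` for which the vector with entries
`[x]_i ‖v_i‖` has distance at most `t` to `e_j` in the maximum norm (the norm of `Fin n → ℝ`). -/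
def rayNhd (Δ : Set (Set (EuclideanSpace ℝ (Fin d)))) (v : Fin n → EuclideanSpace ℝ (Fin d))
    (t : ℝ) (j : Fin n) : Set (EuclideanSpace ℝ (Fin d)) :=
  {x | ‖(fun i => fanCoord Δ v x i * ‖v i‖) - Pi.single j 1‖ ≤ t}

/-- The mean squared error of `Q` for the data `(u_i, y_i)`, `i = 1, …, m`. -/
noncomputable def meanSqError {m : ℕ} (u : Fin m → EuclideanSpace ℝ (Fin d)) (y : Fin m → ℝ)
    (Q : Set (EuclideanSpace ℝ (Fin d))) : ℝ :=
  (1 / (m : ℝ)) * ∑ i, (supportFun Q (u i) - y i) ^ 2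

/-- The least-squares estimate: the set of minimizers of the mean squared error over `𝒫(Δ)`. -/
def leastSquares (Δ : Set (Set (EuclideanSpace ℝ (Fin d)))) {m : ℕ}
    (u : Fin m → EuclideanSpace ℝ (Fin d)) (y : Fin m → ℝ) :
    Set (Set (EuclideanSpace ℝ (Fin d))) :=
  {Q | Q ∈ deformationCone Δ ∧ ∀ R ∈ deformationCone Δ, meanSqError u y Q ≤ meanSqError u y R}

/-- `κ = (δ / max_i ‖v_i‖²)^{3/2}`. -/
noncomputable def kappa (v : Fin n → EuclideanSpace ℝ (Fin d)) (δ : ℝ) : ℝ :=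
  (δ / ⨆ i, ‖v i‖ ^ 2) ^ (3 / 2 : ℝ)

/-- `λ = c² - (c² - t² / min_i ‖v_i‖²) (n - 1) (2.5 n t + δ)` with `c = c^Δ`. -/
noncomputable def lam (Δ : Set (Set (EuclideanSpace ℝ (Fin d))))
    (v : Fin n → EuclideanSpace ℝ (Fin d)) (t δ : ℝ) : ℝ :=
  fanConst Δ v ^ 2 -
    (fanConst Δ v ^ 2 - t ^ 2 / ⨅ i, ‖v i‖ ^ 2) * ((n : ℝ) - 1) * (2.5 * n * t + δ)

end SupportReconstruction

namespace SupportReconstruction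

variable {d n : ℕ}

/-! Coordinates relative to the fan linearise the problem. A polytope lies in 𝒫(Δ) exactly when its
support function is linear on the cones of Δ (`mem_deformationCone_iff`), so it is determined by its
values b at the ray generators. The admissible b are those whose piecewise linear interpolation is
subadditive. They form a closed convex set, and Hahn–Banach supplies the polytope
(`exists_mem_polyhedronOf`). Least squares is therefore metric projection of the data onto the image
of this set under the linear map A = `designMap`.

Directions close to every ray provide rows of A close to multiples of unit vectors, whence ‖Ab‖² ≥
mα‖b‖² with α = `gramConst` (`gram_lower_bound`). So A is injective, and the projection yields
exactly one polytope. Testing the variational inequality of the projection against P gives ‖Az‖² ≤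
⟨z, Aᵀε⟩ for the error z, hence mα‖z‖ ≤ ‖Aᵀε‖. A unit vector has at most d non-zero coordinates,
each at most c, so the Hausdorff distance is at most c√d ‖z‖ (`hausdorffDist_leastSquares_le`).

Each entry of Aᵀε is a weighted Gaussian sum with variance at most γmλ
(`IsGoodDesign.sum_fanCoord_sq_le`). A sub-Gaussian tail bound and a union over the n rays give the
finite-sample estimate. Taking η = 1/(m+1)² and applying Borel–Cantelli gives almost sure
convergence. -/

/-- The face of `P` in direction `x`: all maximizers of `⟨x, ·⟩` over `P`. -/
def faceAt (P : Set (EuclideanSpace ℝ (Fin d))) (x : EuclideanSpace ℝ (Fin d)) :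
    Set (EuclideanSpace ℝ (Fin d)) :=
  {p | p ∈ P ∧ ∀ y ∈ P, inner ℝ x y ≤ inner ℝ x p}

/-! ### Normal cones, their inclusions and their relative interiors. -/

section NormalCone

variable {P F G σ : Set (EuclideanSpace ℝ (Fin d))} {w x y : EuclideanSpace ℝ (Fin d)}

lemma IsPolyhedron.isClosed (hP : IsPolyhedron P) : IsClosed P := by
  obtain ⟨k, a, b, rfl⟩ := hP
  simp only [Set.ofPred_forall]
  exact isClosed_iInter fun i => isClosed_le (by fun_prop) (by fun_prop)

lemma IsPolyhedron.convex (hP : IsPolyhedron P) : Convex ℝ P := by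
  obtain ⟨k, a, b, rfl⟩ := hP
  simp only [Set.ofPred_forall]
  exact convex_iInter fun i => convex_halfSpace_le (innerₛₗ ℝ (a i)).isLinear _

lemma IsPolytope.isCompact (hP : IsPolytope P) : IsCompact P :=
  Metric.isCompact_of_isClosed_isBounded hP.isPolyhedron.isClosed hP.isBounded

lemma IsPolytope.faceAt_nonempty (hP : IsPolytope P) (x : EuclideanSpace ℝ (Fin d)) :
    (faceAt P x).Nonempty := by
  obtain ⟨p, hp, h⟩ := hP.isCompact.exists_isMaxOn hP.nonempty
    (f := fun y => inner ℝ x y) (by fun_prop)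
  exact ⟨p, hp, h⟩

lemma mem_normalFan_iff :
    σ ∈ normalFan P ↔ ∃ w, (faceAt P w).Nonempty ∧ σ = normalCone P (faceAt P w) := by
  constructor
  · rintro ⟨F, hF, hE, rfl⟩
    obtain ⟨l, rfl⟩ := hE hF
    have h : faceAt P ((InnerProductSpace.toDual ℝ _).symm l) =
        {x | x ∈ P ∧ ∀ y ∈ P, l y ≤ l x} := by
      ext x
      simp [faceAt]
    exact ⟨(InnerProductSpace.toDual ℝ _).symm l, by rwa [h], by rw [h]⟩
  · rintro ⟨w, hw, rfl⟩
    exact ⟨_, hw, fun _ => ⟨innerSL ℝ w, by simp [faceAt]⟩, rfl⟩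

lemma mem_normalCone_faceAt (P : Set (EuclideanSpace ℝ (Fin d)))
    (x : EuclideanSpace ℝ (Fin d)) : x ∈ normalCone P (faceAt P x) :=
  fun _ hp => hp.2

lemma IsPolytope.normalCone_faceAt_mem (hP : IsPolytope P) (x : EuclideanSpace ℝ (Fin d)) :
    normalCone P (faceAt P x) ∈ normalFan P :=
  mem_normalFan_iff.2 ⟨x, hP.faceAt_nonempty x, rfl⟩

lemma normalCone_anti (h : F ⊆ G) : normalCone P G ⊆ normalCone P F :=
  fun _ hx p hp => hx p (h hp)

lemma zero_mem_normalCone : (0 : EuclideanSpace ℝ (Fin d)) ∈ normalCone P F := by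
  intro p _ y _
  simp

lemma add_mem_normalCone (hx : x ∈ normalCone P F) (hy : y ∈ normalCone P F) :
    x + y ∈ normalCone P F := by
  intro p hp z hz
  rw [inner_add_left, inner_add_left]
  exact add_le_add (hx p hp z hz) (hy p hp z hz)

lemma smul_mem_normalCone {a : ℝ} (ha : 0 ≤ a) (hx : x ∈ normalCone P F) :
    a • x ∈ normalCone P F := by
  intro p hp z hz
  rw [real_inner_smul_left, real_inner_smul_left]
  exact mul_le_mul_of_nonneg_left (hx p hp z hz) ha

lemma sum_smul_mem_normalCone {ι : Type*} (s : Finset ι) {c : ι → ℝ}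
    {w : ι → EuclideanSpace ℝ (Fin d)} (hc : ∀ i ∈ s, 0 ≤ c i)
    (hw : ∀ i ∈ s, c i ≠ 0 → w i ∈ normalCone P F) : ∑ i ∈ s, c i • w i ∈ normalCone P F := by
  induction s using Finset.cons_induction with
  | empty => simpa using zero_mem_normalCone
  | cons a s ha ih =>
    rw [Finset.sum_cons]
    refine add_mem_normalCone ?_ (ih (fun i hi => hc i (by simp [hi]))
      fun i hi => hw i (by simp [hi]))
    by_cases h : c a = 0
    · simpa [h] using zero_mem_normalCone
    · exact smul_mem_normalCone (hc a (by simp)) (hw a (by simp) h)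

lemma convex_normalCone : Convex ℝ (normalCone P F) := by
  intro x hx y hy a b ha hb _
  exact add_mem_normalCone (smul_mem_normalCone ha hx) (smul_mem_normalCone hb hy)

lemma isClosed_normalCone : IsClosed (normalCone P F) := by
  simp only [normalCone, Set.ofPred_forall]
  exact isClosed_iInter fun _ => isClosed_iInter fun _ => isClosed_iInter fun _ =>
    isClosed_iInter fun _ => isClosed_le (by fun_prop) (by fun_prop)

/-- Passing from faces to normal cones reverses inclusions, so the normal cone at the face of x is
the smallest cone of the fan containing x. -/
lemma normalCone_faceAt_subset (hσ : σ ∈ normalFan P) (hx : x ∈ σ) :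
    normalCone P (faceAt P x) ⊆ σ := by
  obtain ⟨w, -, rfl⟩ := mem_normalFan_iff.1 hσ
  exact normalCone_anti fun p hp => ⟨hp.1, hx p hp⟩

/-- Since x and y share a maximizer, every maximizer of x + y must maximize both. This is the face
property of the cones: the smallest cone of a sum contains the summands. -/
lemma mem_normalCone_faceAt_add (hσ : σ ∈ normalFan P) (hx : x ∈ σ) (hy : y ∈ σ) :
    x ∈ normalCone P (faceAt P (x + y)) := by
  obtain ⟨w, ⟨p, hp⟩, rfl⟩ := mem_normalFan_iff.1 hσ
  intro q hq z hz
  have h := hq.2 p hp.1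
  rw [inner_add_left, inner_add_left] at h
  have h1 := hy p hp q hq.1
  have h2 := hx p hp z hz
  linarith

/-- A point of a polytope's normal fan lies in the relative interior of the smallest cone
containing it, in the sense that segments towards it can be prolonged inside the cone. -/
lemma IsPolytope.exists_prolongation (hP : IsPolytope P) (hfin : (normalFan P).Finite)
    (hy : y ∈ normalCone P (faceAt P x)) :
    ∃ r : ℝ, 0 < r ∧ x + r • (x - y) ∈ normalCone P (faceAt P x) := by
  -- One maximizer per cone yields a finite set of test points that realizes the maximum in every
  -- direction.
  have hsel : ∀ τ ∈ normalFan P, ∃ p ∈ P, ∀ z ∈ τ, ∀ q ∈ P, inner ℝ z q ≤ inner ℝ z p := by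
    intro τ hτ
    obtain ⟨w, ⟨p, hp⟩, rfl⟩ := mem_normalFan_iff.1 hτ
    exact ⟨p, hp.1, fun z hz => hz p hp⟩
  choose! sel hselP hsel using hsel
  obtain ⟨q₀, hq₀⟩ := hP.faceAt_nonempty x
  -- Test points off the face of x satisfy a strict inequality at r = 0, which persists; on that
  -- face both x and y are constant, so equality holds for all r.
  have hev : ∀ᶠ r : ℝ in 𝓝[>] 0, ∀ τ ∈ normalFan P,
      inner ℝ (x + r • (x - y)) (sel τ) ≤ inner ℝ (x + r • (x - y)) q₀ := by
    rw [hfin.eventually_all]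
    intro τ hτ
    rcases (hq₀.2 _ (hselP τ hτ)).lt_or_eq with h | h
    · have hlt : ∀ᶠ r : ℝ in 𝓝 0,
          inner ℝ (x + r • (x - y)) (sel τ) < inner ℝ (x + r • (x - y)) q₀ := by
        refine ContinuousAt.eventually_lt ?_ ?_ (by simpa using h) <;> fun_prop
      exact (hlt.filter_mono nhdsWithin_le_nhds).mono fun r hr => hr.le
    · have hmem : sel τ ∈ faceAt P x := ⟨hselP τ hτ, by rw [h]; exact hq₀.2⟩
      have e : inner ℝ y (sel τ) = inner ℝ y q₀ :=
        le_antisymm (hy q₀ hq₀ _ hmem.1) (hy _ hmem _ hq₀.1)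
      refine Eventually.of_forall fun r => le_of_eq ?_
      simp only [inner_add_left, real_inner_smul_left, inner_sub_left, h, e]
  obtain ⟨r, hr, hr0⟩ := (hev.and self_mem_nhdsWithin).exists
  refine ⟨r, hr0, fun p hp z hz => ?_⟩
  have e1 : inner ℝ x p = inner ℝ x q₀ := le_antisymm (hq₀.2 _ hp.1) (hp.2 _ hq₀.1)
  have e2 : inner ℝ y p = inner ℝ y q₀ := le_antisymm (hy q₀ hq₀ _ hp.1) (hy _ hp _ hq₀.1)
  have e3 : inner ℝ (x + r • (x - y)) p = inner ℝ (x + r • (x - y)) q₀ := by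
    simp only [inner_add_left, real_inner_smul_left, inner_sub_left, e1, e2]
  rw [e3]
  exact (hsel _ (hP.normalCone_faceAt_mem _) _ (mem_normalCone_faceAt P _) z hz).trans
    (hr _ (hP.normalCone_faceAt_mem _))

/-- With y in the relative interior and z = x + r(x - y), the homothety centred at z with ratio (1 +
r)/r sends x to y. It pulls a neighbourhood of y inside s back to one of x, which stays in s by
convexity. -/
lemma mem_intrinsicInterior_of_prolongation {s : Set (EuclideanSpace ℝ (Fin d))}
    (hs : Convex ℝ s) (hx : x ∈ s) (h : ∀ y ∈ s, ∃ r : ℝ, 0 < r ∧ x + r • (x - y) ∈ s) :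
    x ∈ intrinsicInterior ℝ s := by
  obtain ⟨y, hy⟩ := Set.Nonempty.intrinsicInterior hs ⟨x, hx⟩
  obtain ⟨r, hr, hz⟩ := h y (intrinsicInterior_subset hy)
  obtain ⟨y', hy', rfl⟩ := mem_intrinsicInterior.1 hy
  have hxA : x ∈ affineSpan ℝ s := subset_affineSpan ℝ s hx
  have hzA := subset_affineSpan ℝ s hz
  refine mem_intrinsicInterior.2 ⟨⟨x, hxA⟩, ?_, rfl⟩
  rw [mem_interior_iff_mem_nhds] at hy' ⊢
  have hmem : ∀ p : affineSpan ℝ s,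
      AffineMap.lineMap (x + r • (x - (y' : EuclideanSpace ℝ (Fin d)))) (p : EuclideanSpace ℝ (Fin d))
        ((1 + r) / r) ∈ affineSpan ℝ s := fun p => AffineMap.lineMap_mem _ hzA p.2
  let f : affineSpan ℝ s → affineSpan ℝ s := fun p => ⟨_, hmem p⟩
  have hf : Continuous f := by
    refine Continuous.subtype_mk ?_ _
    simp only [AffineMap.lineMap_apply_module]
    fun_prop
  have hfx : f ⟨x, hxA⟩ = y' := by
    ext1
    simp only [f, AffineMap.lineMap_apply_module]
    have : (1 - (1 + r) / r) = - (1 / r) := by field_simp; ring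
    rw [this]
    match_scalars <;> field_simp; ring
  have hpre := hf.continuousAt.preimage_mem_nhds (by rw [hfx]; exact hy')
  refine mem_of_superset hpre fun p hp => ?_
  have hp' : ((f p : affineSpan ℝ s) : EuclideanSpace ℝ (Fin d)) ∈ s := hp
  have : (p : EuclideanSpace ℝ (Fin d)) = (1 / (1 + r)) • (x + r • (x - (y' : EuclideanSpace ℝ (Fin d))))
      + (r / (1 + r)) • (f p : EuclideanSpace ℝ (Fin d)) := by
    simp only [f, AffineMap.lineMap_apply_module]
    have : (1 - (1 + r) / r) = - (1 / r) := by field_simp; ring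
    rw [this]
    match_scalars <;> field_simp <;> ring
  change (p : EuclideanSpace ℝ (Fin d)) ∈ s
  rw [this]
  exact hs hz hp' (by positivity) (by positivity) (by field_simp)

end NormalCone

/-! ### Coordinates with respect to a simplicial fan. -/

section FanCoordinates

variable {Δ : Set (Set (EuclideanSpace ℝ (Fin d)))} {v : Fin n → EuclideanSpace ℝ (Fin d)}
  {σ : Set (EuclideanSpace ℝ (Fin d))} {x y : EuclideanSpace ℝ (Fin d)} {c : Fin n → ℝ}

lemma mem_posHull_finset {I : Finset (Fin n)} :
    x ∈ posHull (fun i : I => v i) ↔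
      ∃ c : Fin n → ℝ, (∀ i, 0 ≤ c i) ∧ (∀ i ∉ I, c i = 0) ∧ x = ∑ i ∈ I, c i • v i := by
  constructor
  · rintro ⟨a, ha, rfl⟩
    refine ⟨fun i => if h : i ∈ I then a ⟨i, h⟩ else 0, fun i => ?_, fun i hi => by simp [hi], ?_⟩
    · by_cases h : i ∈ I
      · simpa [h] using ha _
      · simp [h]
    · rw [← Finset.sum_coe_sort I]
      exact Finset.sum_congr rfl fun i _ => by simp
  · rintro ⟨a, ha, -, rfl⟩
    exact ⟨fun i => a i, fun i => ha i, (Finset.sum_coe_sort I fun i => a i • v i).symm⟩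

lemma eq_of_sum_smul_eq {I : Finset (Fin n)} (hI : LinearIndependent ℝ (fun i : I => v i))
    {a b : Fin n → ℝ} (h : ∑ i ∈ I, a i • v i = ∑ i ∈ I, b i • v i) : ∀ i ∈ I, a i = b i := by
  intro i hi
  have h0 : ∑ i : I, (a i - b i) • v i = 0 := by
    rw [Finset.sum_coe_sort I fun i => (a i - b i) • v i]
    simp [sub_smul, h]
  exact sub_eq_zero.1 (Fintype.linearIndependent_iff.1 hI (fun i => a i - b i) h0 ⟨i, hi⟩)

lemma mem_posHull_singleton {w : EuclideanSpace ℝ (Fin d)} :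
    x ∈ posHull ![w] ↔ ∃ a : ℝ, 0 ≤ a ∧ x = a • w := by
  constructor
  · rintro ⟨c, hc, rfl⟩
    exact ⟨c 0, hc 0, by simp⟩
  · rintro ⟨a, ha, rfl⟩
    exact ⟨fun _ => a, fun _ => ha, by simp⟩

namespace IsSimplicialPolytopalFan

variable (hΔ : IsSimplicialPolytopalFan Δ v)

include hΔ

lemma finite : Δ.Finite := by
  refine (Set.finite_range fun I : Finset (Fin n) => posHull (fun i : I => v i)).subset ?_
  intro σ hσ
  obtain ⟨I, -, rfl⟩ := hΔ.simplicial σ hσ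
  exact ⟨I, rfl⟩

lemma exists_normalCone_eq (hσ : σ ∈ Δ) : ∃ P F, σ = normalCone P F := by
  obtain ⟨P, -, rfl⟩ := hΔ.polytopal
  obtain ⟨F, -, -, h⟩ := hσ
  exact ⟨P, F, h⟩

lemma isClosed (hσ : σ ∈ Δ) : IsClosed σ := by
  obtain ⟨P, F, rfl⟩ := hΔ.exists_normalCone_eq hσ
  exact isClosed_normalCone

lemma smul_mem (hσ : σ ∈ Δ) {a : ℝ} (ha : 0 ≤ a) (hx : x ∈ σ) : a • x ∈ σ := by
  obtain ⟨P, F, rfl⟩ := hΔ.exists_normalCone_eq hσ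
  exact smul_mem_normalCone ha hx

lemma sum_smul_mem (hσ : σ ∈ Δ) (s : Finset (Fin n)) (hc : ∀ i ∈ s, 0 ≤ c i)
    (hv : ∀ i ∈ s, c i ≠ 0 → v i ∈ σ) : ∑ i ∈ s, c i • v i ∈ σ := by
  obtain ⟨P, F, rfl⟩ := hΔ.exists_normalCone_eq hσ
  exact sum_smul_mem_normalCone s hc hv

/-- Every point lies in a smallest cone of the fan, in whose relative interior it is. -/
lemma exists_minimal_cone (x : EuclideanSpace ℝ (Fin d)) :
    ∃ σ ∈ Δ, x ∈ intrinsicInterior ℝ σ ∧ x ∈ σ ∧ (∀ τ ∈ Δ, x ∈ τ → σ ⊆ τ) ∧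
      (∀ τ ∈ Δ, ∀ y ∈ τ, ∀ z ∈ τ, x = y + z → y ∈ σ) ∧
      ∀ y ∈ σ, ∃ r : ℝ, 0 < r ∧ x + r • (x - y) ∈ σ := by
  have hfin := hΔ.finite
  obtain ⟨P, hP, rfl⟩ := hΔ.polytopal
  refine ⟨_, hP.normalCone_faceAt_mem x, ?_, mem_normalCone_faceAt P x,
    fun τ hτ hx => normalCone_faceAt_subset hτ hx, ?_,
    fun y hy => hP.exists_prolongation hfin hy⟩
  · exact mem_intrinsicInterior_of_prolongation convex_normalCone (mem_normalCone_faceAt P x)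
      fun y hy => hP.exists_prolongation hfin hy
  · rintro τ hτ y hy z hz rfl
    exact mem_normalCone_faceAt_add hτ hy hz

lemma ray_mem (j : Fin n) : posHull ![v j] ∈ Δ := (hΔ.rays.mapsTo (Set.mem_univ j)).1

lemma generator_ne_zero (j : Fin n) : v j ≠ 0 := by
  intro h
  have h1 := (hΔ.rays.mapsTo (Set.mem_univ j)).2
  have h2 : posHull ![v j] ⊆ {0} := by
    intro x hx
    obtain ⟨a, -, rfl⟩ := mem_posHull_singleton.1 hx
    simp [h]
  have h3 : Submodule.span ℝ (posHull ![v j]) = ⊥ := by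
    rw [Submodule.span_eq_bot]
    exact fun x hx => h2 hx
  rw [h3, finrank_bot] at h1
  exact zero_ne_one h1

lemma eq_of_mem_ray {i j : Fin n} (h : v i ∈ posHull ![v j]) : i = j := by
  obtain ⟨a, ha, hij⟩ := mem_posHull_singleton.1 h
  have ha0 : a ≠ 0 := fun h0 => hΔ.generator_ne_zero i (by simp [hij, h0])
  have ha' : 0 < a := lt_of_le_of_ne ha (Ne.symm ha0)
  refine hΔ.rays.injOn (Set.mem_univ i) (Set.mem_univ j) ?_
  ext x
  simp only [mem_posHull_singleton]
  constructor
  · rintro ⟨b, hb, rfl⟩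
    exact ⟨b * a, by positivity, by rw [hij, smul_smul]⟩
  · rintro ⟨b, hb, rfl⟩
    exact ⟨b / a, by positivity, by rw [hij, smul_smul, div_mul_cancel₀ _ ha0]⟩

/-- If v_i has a positive coefficient in an expansion of v_j within the cone, the face property puts
v_i in the smallest cone of v_j, hence on the ray of v_j, and so i = j. -/
lemma mem_of_generator_mem {I : Finset (Fin n)} (hI : posHull (fun i : I => v i) ∈ Δ) {j : Fin n}
    (hj : v j ∈ posHull (fun i : I => v i)) : j ∈ I := by
  have hv : ∀ i ∈ I, v i ∈ posHull (fun i : I => v i) := by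
    intro i hi
    refine mem_posHull_finset.2 ⟨Pi.single i 1, fun k => ?_, fun k hk => ?_, ?_⟩
    · exact (Pi.single_nonneg (i := i).2 zero_le_one : (0 : Fin n → ℝ) ≤ Pi.single i 1) k
    · rw [Pi.single_eq_of_ne]
      rintro rfl
      exact hk hi
    · simp [Pi.single_apply, ite_smul, hi]
  obtain ⟨a, ha, -, hja⟩ := mem_posHull_finset.1 hj
  obtain ⟨i, hi, hai⟩ : ∃ i ∈ I, a i ≠ 0 := by
    by_contra! h
    exact hΔ.generator_ne_zero j (by rw [hja]; exact Finset.sum_eq_zero fun i hi => by simp [h i hi])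
  have hpos : 0 < a i := lt_of_le_of_ne (ha i) (Ne.symm hai)
  obtain ⟨σ, -, -, -, hmin, hface, -⟩ := hΔ.exists_minimal_cone (v j)
  have h1 : a i • v i ∈ σ := by
    refine hface _ hI _ (hΔ.smul_mem hI (ha i) (hv i hi)) (∑ k ∈ I.erase i, a k • v k)
      (hΔ.sum_smul_mem hI _ (fun k _ => ha k) fun k hk _ => hv k (Finset.mem_of_mem_erase hk)) ?_
    rw [hja, Finset.add_sum_erase I (fun k => a k • v k) hi]
  have h2 := hmin _ (hΔ.ray_mem j) (mem_posHull_singleton.2 ⟨1, zero_le_one, by simp⟩) h1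
  have h3 := hΔ.smul_mem (hΔ.ray_mem j) (inv_nonneg.2 (ha i)) h2
  rw [smul_smul, inv_mul_cancel₀ hai, one_smul] at h3
  exact hΔ.eq_of_mem_ray h3 ▸ hi

end IsSimplicialPolytopalFan

/-- `c` represents `x` as a non-negative combination of generators of a single cone of `Δ`. -/
structure IsConeRep (Δ : Set (Set (EuclideanSpace ℝ (Fin d))))
    (v : Fin n → EuclideanSpace ℝ (Fin d)) (x : EuclideanSpace ℝ (Fin d)) (c : Fin n → ℝ) :
    Prop where
  nonneg : ∀ i, 0 ≤ c i
  eq_sum : x = ∑ i, c i • v i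
  exists_cone : ∃ σ ∈ Δ, ∀ i, c i ≠ 0 → v i ∈ σ

/-- Non-negativity is not part of `IsFanCoord`: it follows by comparing, through linear
independence, with the non-negative coefficients of a point of the cone. -/
lemma IsFanCoord.isConeRep (hc : IsFanCoord Δ v x c) : IsConeRep Δ v x c := by
  obtain ⟨σ, hσ, hx, I, hI, rfl, hc0, hxc⟩ := hc
  obtain ⟨a, ha, ha0, hxa⟩ := mem_posHull_finset.1 (intrinsicInterior_subset hx)
  have hca : c = a := by
    ext i
    by_cases hi : i ∈ I
    · exact eq_of_sum_smul_eq hI (hxc.symm.trans hxa) i hi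
    · rw [hc0 i hi, ha0 i hi]
  subst hca
  refine ⟨ha, ?_, _, hσ, fun i hi => ?_⟩
  · rw [hxc]
    exact Finset.sum_subset (Finset.subset_univ I) fun i _ hi => by simp [hc0 i hi]
  · have hiI : i ∈ I := by
      by_contra h
      exact hi (hc0 i h)
    exact ⟨Pi.single ⟨i, hiI⟩ 1,
      fun k => (Pi.single_nonneg (i := (⟨i, hiI⟩ : I)).2 zero_le_one :
        (0 : I → ℝ) ≤ Pi.single ⟨i, hiI⟩ 1) k, by simp [Pi.single_apply, ite_smul]⟩

namespace IsSimplicialPolytopalFan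

variable (hΔ : IsSimplicialPolytopalFan Δ v)

include hΔ

/-- Each summand of x lies in the smallest cone of x, which is contained in every cone through x. -/
lemma support_subset (hc : IsConeRep Δ v x c) (hσ : σ ∈ Δ) (hx : x ∈ σ) {i : Fin n}
    (hi : c i ≠ 0) : v i ∈ σ := by
  obtain ⟨τ, hτ, hcτ⟩ := hc.exists_cone
  obtain ⟨ρ, hρ, -, -, hmin, hface, -⟩ := hΔ.exists_minimal_cone x
  have h1 : c i • v i ∈ ρ := by
    refine hface _ hτ _ (hΔ.smul_mem hτ (hc.nonneg i) (hcτ i hi))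
      (∑ k ∈ Finset.univ.erase i, c k • v k)
      (hΔ.sum_smul_mem hτ _ (fun k _ => hc.nonneg k) fun k _ => hcτ k) ?_
    rw [Finset.add_sum_erase _ (fun k => c k • v k) (Finset.mem_univ i)]
    exact hc.eq_sum
  have h2 := hΔ.smul_mem hρ (inv_nonneg.2 (hc.nonneg i)) h1
  rw [smul_smul, inv_mul_cancel₀ hi, one_smul] at h2
  exact hmin σ hσ hx h2

/-- All representations are supported on the linearly independent generators of the smallest cone of
x. This makes the choice made in `fanCoord` harmless. -/
lemma coneRep_unique {c' : Fin n → ℝ} (hc : IsConeRep Δ v x c) (hc' : IsConeRep Δ v x c') :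
    c = c' := by
  obtain ⟨σ, hσ, -, hxσ, -⟩ := hΔ.exists_minimal_cone x
  obtain ⟨I, hI, rfl⟩ := hΔ.simplicial σ hσ
  have key : ∀ {a : Fin n → ℝ}, IsConeRep Δ v x a → (∀ i ∉ I, a i = 0) ∧ x = ∑ i ∈ I, a i • v i := by
    intro a ha
    have h0 : ∀ i ∉ I, a i = 0 := by
      intro i hi
      by_contra h
      exact hi (hΔ.mem_of_generator_mem hσ (hΔ.support_subset ha hσ hxσ h))
    refine ⟨h0, ?_⟩
    rw [Finset.sum_subset (Finset.subset_univ I) fun i _ hi => by simp [h0 i hi]]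
    exact ha.eq_sum
  ext i
  by_cases hi : i ∈ I
  · exact eq_of_sum_smul_eq hI ((key hc).2.symm.trans (key hc').2) i hi
  · rw [(key hc).1 i hi, (key hc').1 i hi]

lemma exists_isFanCoord (x : EuclideanSpace ℝ (Fin d)) : ∃ c, IsFanCoord Δ v x c := by
  obtain ⟨σ, hσ, hx, hxσ, -⟩ := hΔ.exists_minimal_cone x
  obtain ⟨I, hI, h⟩ := hΔ.simplicial σ hσ
  rw [h] at hxσ
  obtain ⟨c, -, hc0, hxc⟩ := mem_posHull_finset.1 hxσ
  exact ⟨c, σ, hσ, hx, I, hI, h, hc0, hxc⟩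

lemma isConeRep_fanCoord (x : EuclideanSpace ℝ (Fin d)) : IsConeRep Δ v x (fanCoord Δ v x) := by
  have h := hΔ.exists_isFanCoord x
  rw [fanCoord, dif_pos h]
  exact h.choose_spec.isConeRep

lemma fanCoord_eq (hc : IsConeRep Δ v x c) : fanCoord Δ v x = c :=
  hΔ.coneRep_unique (hΔ.isConeRep_fanCoord x) hc

lemma fanCoord_nonneg (x : EuclideanSpace ℝ (Fin d)) (i : Fin n) : 0 ≤ fanCoord Δ v x i :=
  (hΔ.isConeRep_fanCoord x).nonneg i

lemma sum_fanCoord_smul (x : EuclideanSpace ℝ (Fin d)) : ∑ i, fanCoord Δ v x i • v i = x :=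
  (hΔ.isConeRep_fanCoord x).eq_sum.symm

lemma generator_mem_of_fanCoord_ne_zero (hσ : σ ∈ Δ) (hx : x ∈ σ) {i : Fin n}
    (hi : fanCoord Δ v x i ≠ 0) : v i ∈ σ :=
  hΔ.support_subset (hΔ.isConeRep_fanCoord x) hσ hx hi

lemma fanCoord_smul {a : ℝ} (ha : 0 ≤ a) (x : EuclideanSpace ℝ (Fin d)) :
    fanCoord Δ v (a • x) = a • fanCoord Δ v x := by
  have h := hΔ.isConeRep_fanCoord x
  obtain ⟨σ, hσ, hs⟩ := h.exists_cone
  refine hΔ.fanCoord_eq ⟨fun i => mul_nonneg ha (h.nonneg i), ?_, σ, hσ, fun i hi => hs i ?_⟩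
  · simp only [Pi.smul_apply, smul_eq_mul, mul_smul, ← Finset.smul_sum]
    rw [← h.eq_sum]
  · intro h0
    simp [h0] at hi

lemma fanCoord_generator (j : Fin n) : fanCoord Δ v (v j) = Pi.single j 1 := by
  refine hΔ.fanCoord_eq ⟨fun i => ?_, ?_, _, hΔ.ray_mem j, fun i hi => ?_⟩
  · exact (Pi.single_nonneg (i := j).2 zero_le_one : (0 : Fin n → ℝ) ≤ Pi.single j 1) i
  · simp [Pi.single_apply, ite_smul]
  · have : i = j := by
      by_contra h
      exact hi (by simp [h])
    subst this
    exact mem_posHull_singleton.2 ⟨1, zero_le_one, by simp⟩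

/-- On each cone of the fan the coordinates are linear. -/
lemma exists_linearMap_eqOn (hσ : σ ∈ Δ) :
    ∃ T : EuclideanSpace ℝ (Fin d) →ₗ[ℝ] (Fin n → ℝ), Set.EqOn (fanCoord Δ v) T σ := by
  obtain ⟨I, hI, h⟩ := hΔ.simplicial σ hσ
  obtain ⟨g, hg⟩ := LinearMap.exists_leftInverse_of_injective
    (Fintype.linearCombination ℝ (fun i : I => v i)) (LinearMap.ker_eq_bot.2
      (linearIndependent_iff_injective_fintypeLinearCombination.1 hI))
  -- A left inverse of the combination map extends the coordinates linearly beyond the span of the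
  -- cone.
  let T := (Fintype.linearCombination ℝ fun i : I => (Pi.single i.1 1 : Fin n → ℝ)) ∘ₗ g
  have hT : ∀ i ∈ I, T (v i) = Pi.single i 1 := by
    intro i hi
    have h1 : g (v i) = Pi.single ⟨i, hi⟩ 1 := by
      have h2 := LinearMap.congr_fun hg (Pi.single ⟨i, hi⟩ 1)
      simpa [Fintype.linearCombination_apply_single] using h2
    simp [T, h1, Fintype.linearCombination_apply_single]
  refine ⟨T, fun x hx => ?_⟩
  have h1 : ∀ i, fanCoord Δ v x i • T (v i) = fanCoord Δ v x i • Pi.single i 1 := by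
    intro i
    by_cases h0 : fanCoord Δ v x i = 0
    · simp [h0]
    · have hi := hΔ.generator_mem_of_fanCoord_ne_zero hσ hx h0
      rw [h] at hi hσ
      rw [hT i (hΔ.mem_of_generator_mem hσ hi)]
  conv_rhs => rw [← hΔ.sum_fanCoord_smul x, map_sum]
  simp only [map_smul, h1]
  ext i
  simp [Finset.sum_apply, Pi.single_apply]

/-- The smallest cone containing `x` is generated by the `v i` with `[x]_i ≠ 0`. -/
lemma exists_cone_of_support (x : EuclideanSpace ℝ (Fin d)) :
    ∃ σ ∈ Δ, x ∈ σ ∧ ∀ y ∈ σ, ∀ i, fanCoord Δ v y i ≠ 0 → fanCoord Δ v x i ≠ 0 := by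
  obtain ⟨σ, hσ, hx, hxσ, hmin, hface, hpro⟩ := hΔ.exists_minimal_cone x
  refine ⟨σ, hσ, hxσ, fun y hy i hi h0 => ?_⟩
  -- If [x]_i = 0 < [y]_i, prolonging the segment from y beyond x inside the cone would make
  -- coordinate i equal to -r[y]_i < 0.
  obtain ⟨r, hr, hz⟩ := hpro y hy
  obtain ⟨T, hT⟩ := hΔ.exists_linearMap_eqOn hσ
  have h := hΔ.fanCoord_nonneg (x + r • (x - y)) i
  rw [hT hz, map_add, map_smul, map_sub, ← hT hxσ, ← hT hy] at h
  simp only [Pi.add_apply, Pi.smul_apply, Pi.sub_apply, h0, smul_eq_mul] at h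
  have hy0 : 0 < fanCoord Δ v y i := lt_of_le_of_ne (hΔ.fanCoord_nonneg y i) (Ne.symm hi)
  nlinarith

lemma exists_mem_cone (x : EuclideanSpace ℝ (Fin d)) : ∃ σ ∈ Δ, x ∈ σ := by
  obtain ⟨σ, hσ, -, hx, -⟩ := hΔ.exists_minimal_cone x
  exact ⟨σ, hσ, hx⟩

/-- Finitely many closed cones cover the space, and the coordinates are linear on each of them. -/
lemma continuous_fanCoord : Continuous (fanCoord Δ v) := by
  have := hΔ.finite.to_subtype
  refine LocallyFinite.continuous (f := fun σ : Δ => (σ : Set (EuclideanSpace ℝ (Fin d))))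
    (locallyFinite_of_finite _) ?_ (fun σ => hΔ.isClosed σ.2) fun σ => ?_
  · refine Set.eq_univ_of_forall fun x => ?_
    obtain ⟨σ, hσ, hx⟩ := hΔ.exists_mem_cone x
    exact Set.mem_iUnion.2 ⟨⟨σ, hσ⟩, hx⟩
  · obtain ⟨T, hT⟩ := hΔ.exists_linearMap_eqOn σ.2
    exact (T.continuous_of_finiteDimensional.continuousOn).congr hT

lemma bddAbove_fanCoord :
    BddAbove {r | ∃ (u : EuclideanSpace ℝ (Fin d)) (i : Fin n), ‖u‖ = 1 ∧ r = fanCoord Δ v u i} := by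
  obtain ⟨C, hC⟩ := (isCompact_sphere (0 : EuclideanSpace ℝ (Fin d)) 1).exists_bound_of_continuousOn
    hΔ.continuous_fanCoord.continuousOn
  refine ⟨C, ?_⟩
  rintro _ ⟨u, i, hu, rfl⟩
  exact (le_abs_self _).trans ((norm_le_pi_norm (fanCoord Δ v u) i).trans (hC u (by simpa using hu)))

lemma fanCoord_le_fanConst {u : EuclideanSpace ℝ (Fin d)} (hu : ‖u‖ = 1) (i : Fin n) :
    fanCoord Δ v u i ≤ fanConst Δ v :=
  le_csSup hΔ.bddAbove_fanCoord ⟨u, i, hu, rfl⟩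

lemma inv_norm_le_fanConst (j : Fin n) : ‖v j‖⁻¹ ≤ fanConst Δ v := by
  have hv := hΔ.generator_ne_zero j
  have h := hΔ.fanCoord_le_fanConst (u := ‖v j‖⁻¹ • v j) (by
    rw [norm_smul, norm_inv, norm_norm, inv_mul_cancel₀ (norm_ne_zero_iff.2 hv)]) j
  rw [hΔ.fanCoord_smul (by positivity), hΔ.fanCoord_generator] at h
  simpa using h

/-- The generators of a single cone are linearly independent; this is the source of the factor d in
the error bound. -/
lemma card_support_le (x : EuclideanSpace ℝ (Fin d)) :
    (Finset.univ.filter fun i => fanCoord Δ v x i ≠ 0).card ≤ d := by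
  obtain ⟨σ, hσ, hx⟩ := hΔ.exists_mem_cone x
  obtain ⟨I, hI, h⟩ := hΔ.simplicial σ hσ
  have h1 : (Finset.univ.filter fun i => fanCoord Δ v x i ≠ 0) ⊆ I := by
    intro i hi
    have h2 := hΔ.generator_mem_of_fanCoord_ne_zero hσ hx (Finset.mem_filter.1 hi).2
    rw [h] at h2 hσ
    exact hΔ.mem_of_generator_mem hσ h2
  refine (Finset.card_le_card h1).trans ?_
  simpa using hI.fintype_card_le_finrank

end IsSimplicialPolytopalFan

end FanCoordinates

/-! ### Support functions and the Hausdorff distance. -/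

section SupportFunction

variable {Q R : Set (EuclideanSpace ℝ (Fin d))} {x u : EuclideanSpace ℝ (Fin d)}

namespace IsPolytope

lemma exists_eq_supportFun (hQ : IsPolytope Q) (u : EuclideanSpace ℝ (Fin d)) :
    ∃ p ∈ Q, supportFun Q u = inner ℝ p u ∧ ∀ x ∈ Q, inner ℝ x u ≤ inner ℝ p u := by
  obtain ⟨p, hp, h⟩ := hQ.isCompact.exists_isMaxOn hQ.nonempty
    (f := fun x => inner ℝ x u) (by fun_prop)
  refine ⟨p, hp, ?_, h⟩
  refine IsGreatest.csSup_eq ⟨⟨p, hp, rfl⟩, ?_⟩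
  rintro _ ⟨x, hx, rfl⟩
  exact h hx

lemma inner_le_supportFun (hQ : IsPolytope Q) (hx : x ∈ Q) : inner ℝ x u ≤ supportFun Q u := by
  obtain ⟨p, -, h, hmax⟩ := hQ.exists_eq_supportFun u
  rw [h]
  exact hmax x hx

lemma supportFun_add_le (hQ : IsPolytope Q) (x y : EuclideanSpace ℝ (Fin d)) :
    supportFun Q (x + y) ≤ supportFun Q x + supportFun Q y := by
  obtain ⟨p, hp, h, -⟩ := hQ.exists_eq_supportFun (x + y)
  rw [h, inner_add_right]
  exact add_le_add (hQ.inner_le_supportFun hp) (hQ.inner_le_supportFun hp)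

lemma mem_of_forall_inner_le (hQ : IsPolytope Q) (h : ∀ u, inner ℝ x u ≤ supportFun Q u) :
    x ∈ Q := by
  by_contra hx
  obtain ⟨f, a, hfx, hf⟩ := geometric_hahn_banach_point_closed hQ.isPolyhedron.convex
    hQ.isPolyhedron.isClosed hx
  let w := (InnerProductSpace.toDual ℝ _).symm f
  have hw : ∀ y, inner ℝ y (-w) = -f y := fun y => by
    rw [inner_neg_right, real_inner_comm, InnerProductSpace.toDual_symm_apply]
  obtain ⟨p, hp, hpw, -⟩ := hQ.exists_eq_supportFun (-w)
  have h1 := h (-w)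
  rw [hpw, hw, hw] at h1
  linarith [hf p hp]

/-- For the nearest point y of Q and w the unit vector along x - y, Q lies below y in direction w,
so ‖x - y‖ ≤ h_R(w) - h_Q(w). The alternative x = y covers the case without such a w, since r may be
negative here. -/
lemma exists_dist_le (hQ : IsPolytope Q) (hR : IsPolytope R) {r : ℝ}
    (h : ∀ u : EuclideanSpace ℝ (Fin d), ‖u‖ = 1 → supportFun R u ≤ supportFun Q u + r)
    (hx : x ∈ R) : ∃ y ∈ Q, dist x y ≤ r ∨ x = y := by
  obtain ⟨y, hy, hxy⟩ := exists_norm_eq_iInf_of_complete_convex hQ.nonempty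
    hQ.isPolyhedron.isClosed.isComplete hQ.isPolyhedron.convex x
  rw [norm_eq_iInf_iff_real_inner_le_zero hQ.isPolyhedron.convex hy] at hxy
  refine ⟨y, hy, or_iff_not_imp_right.2 fun hne => ?_⟩
  have hpos : 0 < ‖x - y‖ := norm_pos_iff.2 (sub_ne_zero.2 hne)
  set w := ‖x - y‖⁻¹ • (x - y) with hw
  have hw1 : ‖w‖ = 1 := by rw [hw, norm_smul, norm_inv, norm_norm, inv_mul_cancel₀ hpos.ne']
  obtain ⟨p, hp, hpw, -⟩ := hQ.exists_eq_supportFun w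
  have h1 := (hR.inner_le_supportFun (u := w) hx).trans (h w hw1)
  have h2 : inner ℝ (p - y) w ≤ 0 := by
    rw [hw, real_inner_smul_right, real_inner_comm]
    exact mul_nonpos_of_nonneg_of_nonpos (by positivity) (hxy p hp)
  have h3 : inner ℝ (x - y) w = ‖x - y‖ := by
    rw [hw, real_inner_smul_right, real_inner_self_eq_norm_sq]
    field_simp
  rw [inner_sub_left] at h2 h3
  rw [dist_eq_norm]
  linarith

lemma hausdorffDist_le (hQ : IsPolytope Q) (hR : IsPolytope R) {r : ℝ} (hr : 0 ≤ r)
    (h : ∀ u : EuclideanSpace ℝ (Fin d), ‖u‖ = 1 → |supportFun Q u - supportFun R u| ≤ r) :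
    Metric.hausdorffDist Q R ≤ r := by
  refine Metric.hausdorffDist_le_of_mem_dist hr (fun x hx => ?_) fun x hx => ?_
  · obtain ⟨y, hy, hd | rfl⟩ := hR.exists_dist_le hQ (r := r)
      (fun u hu => by linarith [abs_le.1 (h u hu)]) hx
    · exact ⟨y, hy, hd⟩
    · exact ⟨x, hy, by simpa using hr⟩
  · obtain ⟨y, hy, hd | rfl⟩ := hQ.exists_dist_le hR (r := r)
      (fun u hu => by linarith [abs_le.1 (h u hu)]) hx
    · exact ⟨y, hy, hd⟩
    · exact ⟨x, hy, by simpa using hr⟩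

end IsPolytope

end SupportFunction

/-! ### The deformation cone as a closed convex set of vectors in ℝⁿ. -/

section DeformationCone

variable {Δ : Set (Set (EuclideanSpace ℝ (Fin d)))} {v : Fin n → EuclideanSpace ℝ (Fin d)}
  {b : Fin n → ℝ} {Q R : Set (EuclideanSpace ℝ (Fin d))} {x u : EuclideanSpace ℝ (Fin d)}

/-- The function that is linear on the cones of `Δ` and takes the value `b i` at `v i`. -/
noncomputable def interp (Δ : Set (Set (EuclideanSpace ℝ (Fin d))))
    (v : Fin n → EuclideanSpace ℝ (Fin d)) (b : Fin n → ℝ) (u : EuclideanSpace ℝ (Fin d)) : ℝ :=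
  ∑ i, fanCoord Δ v u i * b i

/-- The vectors `b` for which `interp Δ v b` is subadditive. -/
def subadditiveVectors (Δ : Set (Set (EuclideanSpace ℝ (Fin d))))
    (v : Fin n → EuclideanSpace ℝ (Fin d)) : Set (Fin n → ℝ) :=
  {b | ∀ x y, interp Δ v b (x + y) ≤ interp Δ v b x + interp Δ v b y}

/-- The values of the support function at the ray generators. -/
noncomputable def supportVec (v : Fin n → EuclideanSpace ℝ (Fin d))
    (Q : Set (EuclideanSpace ℝ (Fin d))) : Fin n → ℝ :=
  fun i => supportFun Q (v i)

/-- The polyhedron with outer normals `v i` and right-hand sides `b i`. -/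
def polyhedronOf (v : Fin n → EuclideanSpace ℝ (Fin d)) (b : Fin n → ℝ) :
    Set (EuclideanSpace ℝ (Fin d)) :=
  {x | ∀ i, inner ℝ (v i) x ≤ b i}

lemma interp_sub (a b : Fin n → ℝ) : interp Δ v (a - b) u = interp Δ v a u - interp Δ v b u := by
  simp [interp, mul_sub]

lemma isClosed_subadditiveVectors : IsClosed (subadditiveVectors Δ v) := by
  simp only [subadditiveVectors, interp, Set.ofPred_forall]
  exact isClosed_iInter fun _ => isClosed_iInter fun _ => isClosed_le (by fun_prop) (by fun_prop)

lemma convex_subadditiveVectors : Convex ℝ (subadditiveVectors Δ v) := by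
  intro a ha b hb s t hs ht _ x y
  have h : ∀ z, interp Δ v (s • a + t • b) z = s * interp Δ v a z + t * interp Δ v b z := by
    intro z
    simp only [interp, Finset.mul_sum, ← Finset.sum_add_distrib]
    exact Finset.sum_congr rfl fun i _ => by simp; ring
  rw [h, h, h]
  nlinarith [mul_le_mul_of_nonneg_left (ha x y) hs, mul_le_mul_of_nonneg_left (hb x y) ht]

namespace IsSimplicialPolytopalFan

variable (hΔ : IsSimplicialPolytopalFan Δ v)

include hΔ

lemma interp_smul {a : ℝ} (ha : 0 ≤ a) (b : Fin n → ℝ) (u : EuclideanSpace ℝ (Fin d)) :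
    interp Δ v b (a • u) = a * interp Δ v b u := by
  simp [interp, hΔ.fanCoord_smul ha, Finset.mul_sum, mul_assoc]

lemma interp_generator (b : Fin n → ℝ) (j : Fin n) : interp Δ v b (v j) = b j := by
  simp [interp, hΔ.fanCoord_generator, Pi.single_apply]

lemma inner_eq_sum (x u : EuclideanSpace ℝ (Fin d)) :
    inner ℝ x u = ∑ i, fanCoord Δ v u i * inner ℝ x (v i) := by
  conv_lhs => rw [← hΔ.sum_fanCoord_smul u, inner_sum]
  simp [real_inner_smul_right]

lemma inner_le_interp (hx : x ∈ polyhedronOf v b) (u : EuclideanSpace ℝ (Fin d)) :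
    inner ℝ x u ≤ interp Δ v b u := by
  rw [hΔ.inner_eq_sum]
  refine Finset.sum_le_sum fun i _ => mul_le_mul_of_nonneg_left ?_ (hΔ.fanCoord_nonneg u i)
  rw [real_inner_comm]
  exact hx i

/-- A polytope belongs to the deformation cone iff its support function is linear on the cones
of the fan. -/
lemma mem_deformationCone_iff : Q ∈ deformationCone Δ ↔
    IsPolytope Q ∧ ∀ u, supportFun Q u = interp Δ v (supportVec v Q) u := by
  refine and_congr_right fun hQ => ⟨fun hco u => ?_, fun hlin => ?_⟩
  -- A cone of Δ containing u lies in the normal cone at the face of u, so one maximizer p computes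
  -- h_Q at u and at all generators that occur in u.
  · obtain ⟨S, hS, hU⟩ := hco _ (hQ.normalCone_faceAt_mem u)
    have hu := mem_normalCone_faceAt Q u
    rw [hU] at hu
    obtain ⟨σ, hσS, huσ⟩ := hu
    obtain ⟨p, hp⟩ := hQ.faceAt_nonempty u
    have hsup : ∀ w ∈ normalCone Q (faceAt Q u), supportFun Q w = inner ℝ p w := by
      intro w hw
      obtain ⟨q, hq, hqw, -⟩ := hQ.exists_eq_supportFun w
      refine le_antisymm ?_ (hQ.inner_le_supportFun hp.1)
      have := hw p hp q hq
      rwa [hqw, real_inner_comm w, real_inner_comm w]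
    rw [hsup u (mem_normalCone_faceAt Q u), hΔ.inner_eq_sum]
    refine Finset.sum_congr rfl fun i _ => ?_
    by_cases h0 : fanCoord Δ v u i = 0
    · simp [h0]
    · have hi := hΔ.generator_mem_of_fanCoord_ne_zero (hS hσS) huσ h0
      rw [supportVec, hsup (v i)]
      rw [hU]
      exact ⟨σ, hσS, hi⟩
  · rintro _ ⟨F, hF, hE, rfl⟩
    refine ⟨{σ | σ ∈ Δ ∧ σ ⊆ normalCone Q F}, fun σ hσ => hσ.1, ?_⟩
    refine Set.Subset.antisymm (fun x hx => ?_) (Set.sUnion_subset fun σ hσ => hσ.2)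
    obtain ⟨σ, hσ, hxσ, hsupp⟩ := hΔ.exists_cone_of_support x
    refine ⟨σ, ⟨hσ, fun y hy p hp z hz => ?_⟩, hxσ⟩
    have hFQ : F ⊆ Q := hE.subset
    -- The weighted inequalities ⟨p, v_i⟩ ≤ h_Q(v_i) add up to an equality at x, so each one with
    -- positive weight is an equality. The smallest cone of x involves only these generators, hence
    -- lies in the normal cone.
    have hv : ∀ i, fanCoord Δ v x i ≠ 0 → supportFun Q (v i) = inner ℝ p (v i) := by
      obtain ⟨q, hq, hqx, -⟩ := hQ.exists_eq_supportFun x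
      have h1 : interp Δ v (supportVec v Q) x ≤ inner ℝ p x := by
        rw [← hlin, hqx, real_inner_comm x, real_inner_comm x]
        exact hx p hp q hq
      rw [hΔ.inner_eq_sum] at h1
      have hle : ∀ i ∈ Finset.univ, fanCoord Δ v x i * inner ℝ p (v i) ≤
          fanCoord Δ v x i * supportVec v Q i := fun i _ =>
        mul_le_mul_of_nonneg_left (hQ.inner_le_supportFun (hFQ hp)) (hΔ.fanCoord_nonneg x i)
      have heq := (Finset.sum_eq_sum_iff_of_le hle).1 (le_antisymm (Finset.sum_le_sum hle) h1)
      intro i hi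
      exact (mul_left_cancel₀ hi (heq i (Finset.mem_univ i))).symm
    rw [real_inner_comm z, real_inner_comm p]
    refine (hQ.inner_le_supportFun hz).trans (le_of_eq ?_)
    rw [hlin, hΔ.inner_eq_sum]
    refine Finset.sum_congr rfl fun i _ => ?_
    by_cases h0 : fanCoord Δ v y i = 0
    · simp [h0]
    · rw [supportVec, hv i (hsupp y hy i h0)]

lemma supportVec_mem (hQ : Q ∈ deformationCone Δ) : supportVec v Q ∈ subadditiveVectors Δ v := by
  obtain ⟨hQ, hlin⟩ := hΔ.mem_deformationCone_iff.1 hQ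
  intro x y
  rw [← hlin, ← hlin, ← hlin]
  exact hQ.supportFun_add_le x y

lemma eq_polyhedronOf (hQ : Q ∈ deformationCone Δ) : Q = polyhedronOf v (supportVec v Q) := by
  obtain ⟨hQ, hlin⟩ := hΔ.mem_deformationCone_iff.1 hQ
  refine Set.Subset.antisymm (fun x hx i => ?_) fun x hx => hQ.mem_of_forall_inner_le fun u => ?_
  · rw [real_inner_comm]
    exact hQ.inner_le_supportFun hx
  · rw [hlin]
    exact hΔ.inner_le_interp hx u

/-- The interpolant is sublinear, so Hahn–Banach extends the functional on the line through u that
agrees with it at u; the Riesz vector of the extension is the required point. This gives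
non-emptiness and the support function at once. -/
lemma exists_mem_polyhedronOf (hb : b ∈ subadditiveVectors Δ v) (u : EuclideanSpace ℝ (Fin d)) :
    ∃ x ∈ polyhedronOf v b, inner ℝ x u = interp Δ v b u := by
  have hzero : interp Δ v b 0 = 0 := by
    simpa using hΔ.interp_smul le_rfl b 0
  have H : ∀ c : ℝ, c • u = 0 → c • interp Δ v b u = 0 := by
    intro c hc
    rcases smul_eq_zero.1 hc with rfl | rfl
    · simp
    · rw [hzero, smul_zero]
  obtain ⟨f, hf1, hf2⟩ := exists_extension_of_le_sublinear
    (LinearPMap.mkSpanSingleton' u (interp Δ v b u) H) (interp Δ v b)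
    (fun c hc x => hΔ.interp_smul hc.le b x) hb (by
      rintro ⟨x, hx⟩
      obtain ⟨c, rfl⟩ := Submodule.mem_span_singleton.1 hx
      rw [LinearPMap.mkSpanSingleton'_apply]
      rcases le_total 0 c with hc | hc
      · exact (hΔ.interp_smul hc b u).ge
      · have h1 := hΔ.interp_smul (neg_nonneg.2 hc) b u
        have h2 := hb (c • u) (-c • u)
        rw [← add_smul, add_neg_cancel, zero_smul, hzero, h1] at h2
        simp only [RingHom.id_apply, smul_eq_mul]
        linarith)
  have hfu : f u = interp Δ v b u := by
    have h1 := hf1 ⟨(1 : ℝ) • u, Submodule.smul_mem _ _ (Submodule.mem_span_singleton_self u)⟩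
    rw [LinearPMap.mkSpanSingleton'_apply] at h1
    simpa using h1
  let x := (InnerProductSpace.toDual ℝ _).symm (LinearMap.toContinuousLinearMap f)
  have hx : ∀ y, inner ℝ x y = f y := fun y => by
    rw [InnerProductSpace.toDual_symm_apply]
    rfl
  refine ⟨x, fun i => ?_, by rw [hx, hfu]⟩
  rw [real_inner_comm, hx, ← hΔ.interp_generator b i]
  exact hf2 _

/-- Testing x against x/‖x‖ bounds ‖x‖ by the maximum of the continuous interpolant on the sphere.
-/
lemma isBounded_polyhedronOf (b : Fin n → ℝ) : Bornology.IsBounded (polyhedronOf v b) := by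
  have hcont : Continuous (interp Δ v b) := by
    have := hΔ.continuous_fanCoord
    unfold interp
    fun_prop
  obtain ⟨C, hC⟩ := (isCompact_sphere (0 : EuclideanSpace ℝ (Fin d)) 1).exists_bound_of_continuousOn
    hcont.continuousOn
  refine (Metric.isBounded_closedBall (x := 0) (r := max C 0)).subset fun x hx => ?_
  rw [mem_closedBall_zero_iff]
  by_cases h0 : x = 0
  · simp [h0]
  · have hpos : 0 < ‖x‖ := norm_pos_iff.2 h0
    have h1 := hΔ.inner_le_interp hx (‖x‖⁻¹ • x)
    have h2 := hC (‖x‖⁻¹ • x) (by simp [norm_smul, hpos.ne'])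
    rw [real_inner_smul_right, real_inner_self_eq_norm_sq] at h1
    have h3 : ‖x‖⁻¹ * ‖x‖ ^ 2 = ‖x‖ := by field_simp
    exact le_max_of_le_left (by rw [← h3]; exact h1.trans ((le_abs_self _).trans h2))

lemma isPolytope_polyhedronOf (hb : b ∈ subadditiveVectors Δ v) :
    IsPolytope (polyhedronOf v b) where
  nonempty := by
    obtain ⟨x, hx, -⟩ := hΔ.exists_mem_polyhedronOf hb 0
    exact ⟨x, hx⟩
  isPolyhedron := ⟨n, v, b, rfl⟩
  isBounded := hΔ.isBounded_polyhedronOf b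

lemma supportFun_polyhedronOf (hb : b ∈ subadditiveVectors Δ v) (u : EuclideanSpace ℝ (Fin d)) :
    supportFun (polyhedronOf v b) u = interp Δ v b u := by
  obtain ⟨x, hx, hxu⟩ := hΔ.exists_mem_polyhedronOf hb u
  obtain ⟨p, hp, hpu, -⟩ := (hΔ.isPolytope_polyhedronOf hb).exists_eq_supportFun u
  refine le_antisymm ?_ ?_
  · rw [hpu]
    exact hΔ.inner_le_interp hp u
  · rw [← hxu]
    exact (hΔ.isPolytope_polyhedronOf hb).inner_le_supportFun hx

lemma supportVec_polyhedronOf (hb : b ∈ subadditiveVectors Δ v) :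
    supportVec v (polyhedronOf v b) = b := by
  ext i
  rw [supportVec, hΔ.supportFun_polyhedronOf hb, hΔ.interp_generator]

lemma polyhedronOf_mem (hb : b ∈ subadditiveVectors Δ v) :
    polyhedronOf v b ∈ deformationCone Δ := by
  refine hΔ.mem_deformationCone_iff.2 ⟨hΔ.isPolytope_polyhedronOf hb, fun u => ?_⟩
  rw [hΔ.supportFun_polyhedronOf hb, hΔ.supportVec_polyhedronOf hb]

lemma supportFun_eq (hQ : Q ∈ deformationCone Δ) (u : EuclideanSpace ℝ (Fin d)) :
    supportFun Q u = interp Δ v (supportVec v Q) u :=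
  (hΔ.mem_deformationCone_iff.1 hQ).2 u

lemma sum_fanCoord_sq_le (hu : ‖u‖ = 1) :
    ∑ i, fanCoord Δ v u i ^ 2 ≤ d * fanConst Δ v ^ 2 := by
  have h1 : ∑ i, fanCoord Δ v u i ^ 2 =
      ∑ i with fanCoord Δ v u i ≠ 0, fanCoord Δ v u i ^ 2 := by
    rw [Finset.sum_filter]
    refine Finset.sum_congr rfl fun i _ => ?_
    by_cases h : fanCoord Δ v u i = 0 <;> simp [h]
  rw [h1]
  refine (Finset.sum_le_card_nsmul _ _ (fanConst Δ v ^ 2) fun i _ =>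
    pow_le_pow_left₀ (hΔ.fanCoord_nonneg u i) (hΔ.fanCoord_le_fanConst hu i) 2).trans ?_
  rw [nsmul_eq_mul]
  gcongr
  exact hΔ.card_support_le u

/-- Cauchy–Schwarz in fan coordinates reduces the geometric error to the Euclidean error at the
generators. -/
lemma hausdorffDist_le (hQ : Q ∈ deformationCone Δ) (hR : R ∈ deformationCone Δ) :
    Metric.hausdorffDist Q R ≤
      √(d * fanConst Δ v ^ 2 * ∑ i, (supportVec v Q i - supportVec v R i) ^ 2) := by
  refine hQ.1.hausdorffDist_le hR.1 (by positivity) fun u hu => Real.abs_le_sqrt ?_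
  rw [hΔ.supportFun_eq hQ, hΔ.supportFun_eq hR, ← interp_sub]
  refine (Finset.sum_mul_sq_le_sq_mul_sq _ _ _).trans ?_
  exact mul_le_mul_of_nonneg_right (hΔ.sum_fanCoord_sq_le hu)
    (Finset.sum_nonneg fun i _ => sq_nonneg _)

end IsSimplicialPolytopalFan

end DeformationCone

/-! ### Quadratic estimates for the design. -/

/-- If sufficiently many rows of a matrix are close to each unit vector, the matrix is bounded
below as a linear map. -/
lemma mul_sum_sq_le_of_rows_near_basis {ι : Type*} [Fintype ι] [DecidableEq ι] (w : ι → Fin n → ℝ)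
    (S : Fin n → Finset ι) (hS : Pairwise (Function.onFun Disjoint S)) {t w₀ : ℝ}
    (hw : ∀ j, ∀ ℓ ∈ S j, ∀ k, |w ℓ k - (Pi.single j 1 : Fin n → ℝ) k| ≤ t) (hw₀ : 0 ≤ w₀)
    (ht : 0 ≤ t) (hcard : ∀ j, w₀ ≤ ((S j).card : ℝ)) (b : Fin n → ℝ) :
    w₀ * (1 - 2 * t * n) * ∑ j, b j ^ 2 ≤ ∑ ℓ, (∑ k, w ℓ k * b k) ^ 2 := by
  set B := ∑ k, |b k| with hB
  have hB0 : 0 ≤ B := Finset.sum_nonneg fun _ _ => abs_nonneg _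
  -- From z² ≥ b_j² + 2b_j(z - b_j), where the row value z differs from b_j by at most tB.
  have hrow : ∀ j, ∀ ℓ ∈ S j, b j ^ 2 - 2 * t * (|b j| * B) ≤ (∑ k, w ℓ k * b k) ^ 2 := by
    intro j ℓ hℓ
    have h1 : |∑ k, w ℓ k * b k - b j| ≤ t * B := by
      have h2 : ∑ k, w ℓ k * b k - b j = ∑ k, (w ℓ k - (Pi.single j 1 : Fin n → ℝ) k) * b k := by
        simp [sub_mul, Finset.sum_sub_distrib, Pi.single_apply]
      rw [h2, hB, Finset.mul_sum]
      refine (Finset.abs_sum_le_sum_abs _ _).trans (Finset.sum_le_sum fun k _ => ?_)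
      rw [abs_mul]
      exact mul_le_mul_of_nonneg_right (hw j ℓ hℓ k) (abs_nonneg _)
    set z := ∑ k, w ℓ k * b k
    have h3 : |b j * (z - b j)| ≤ |b j| * (t * B) := by
      rw [abs_mul]
      exact mul_le_mul_of_nonneg_left h1 (abs_nonneg _)
    nlinarith [(abs_le.1 h3).1, sq_nonneg (z - b j)]
  have hcell : ∀ j, w₀ * (b j ^ 2 - 2 * t * (|b j| * B)) ≤ ∑ ℓ ∈ S j, (∑ k, w ℓ k * b k) ^ 2 := by
    intro j
    rcases le_total (b j ^ 2 - 2 * t * (|b j| * B)) 0 with h | h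
    · exact (mul_nonpos_of_nonneg_of_nonpos hw₀ h).trans
        (Finset.sum_nonneg fun _ _ => sq_nonneg _)
    · refine (mul_le_mul_of_nonneg_right (hcard j) h).trans ?_
      rw [← nsmul_eq_mul]
      exact Finset.card_nsmul_le_sum _ _ _ (hrow j)
  have hsum : ∑ j, (b j ^ 2 - 2 * t * (|b j| * B)) = ∑ j, b j ^ 2 - 2 * t * B ^ 2 := by
    rw [Finset.sum_sub_distrib, ← Finset.mul_sum, ← Finset.sum_mul, ← hB, sq]
  have hCS : B ^ 2 ≤ n * ∑ j, b j ^ 2 := by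
    have := sq_sum_le_card_mul_sum_sq (s := Finset.univ) (f := fun k => |b k|)
    simpa using this
  calc w₀ * (1 - 2 * t * n) * ∑ j, b j ^ 2
      ≤ w₀ * (∑ j, b j ^ 2 - 2 * t * B ^ 2) := by
        rw [mul_assoc]
        refine mul_le_mul_of_nonneg_left ?_ hw₀
        nlinarith [mul_le_mul_of_nonneg_left hCS ht]
    _ = ∑ j, w₀ * (b j ^ 2 - 2 * t * (|b j| * B)) := by rw [← hsum, Finset.mul_sum]
    _ ≤ ∑ j, ∑ ℓ ∈ S j, (∑ k, w ℓ k * b k) ^ 2 := Finset.sum_le_sum fun j _ => hcell j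
    _ = ∑ ℓ ∈ Finset.univ.biUnion S, (∑ k, w ℓ k * b k) ^ 2 :=
        (Finset.sum_biUnion fun i _ j _ hij => hS hij).symm
    _ ≤ _ := Finset.sum_le_sum_of_subset_of_nonneg (Finset.subset_univ _)
        fun _ _ _ => sq_nonneg _

section Design

variable {Δ : Set (Set (EuclideanSpace ℝ (Fin d)))} {v : Fin n → EuclideanSpace ℝ (Fin d)}
  {m : ℕ} {u : Fin m → EuclideanSpace ℝ (Fin d)} {t δ : ℝ}

/-- The indices of the directions that lie near the `j`-th ray. -/
noncomputable def nearRay (Δ : Set (Set (EuclideanSpace ℝ (Fin d))))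
    (v : Fin n → EuclideanSpace ℝ (Fin d)) (t : ℝ) (u : Fin m → EuclideanSpace ℝ (Fin d))
    (j : Fin n) : Finset (Fin m) :=
  (Set.toFinite {ℓ | u ℓ ∈ rayNhd Δ v t j}).toFinset

lemma abs_sub_single_le {x : EuclideanSpace ℝ (Fin d)} {j : Fin n} (hx : x ∈ rayNhd Δ v t j)
    (k : Fin n) : |fanCoord Δ v x k * ‖v k‖ - (Pi.single j 1 : Fin n → ℝ) k| ≤ t :=
  (norm_le_pi_norm ((fun i => fanCoord Δ v x i * ‖v i‖) - Pi.single j 1) k).trans hx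

lemma mem_rayNhd_of_mem_nearRay {j : Fin n} {ℓ : Fin m} (h : ℓ ∈ nearRay Δ v t u j) :
    u ℓ ∈ rayNhd Δ v t j :=
  (Set.toFinite {ℓ | u ℓ ∈ rayNhd Δ v t j}).mem_toFinset.1 h

/-- For t < 1/2 the i-th scaled coordinate cannot be within t of both 1 and 0. -/
lemma pairwise_disjoint_nearRay (ht : t < 1 / 2) :
    Pairwise (Function.onFun Disjoint (nearRay Δ v t u)) := by
  intro i j hij
  refine Finset.disjoint_left.2 fun ℓ hi hj => ?_
  have h1 := abs_sub_single_le (mem_rayNhd_of_mem_nearRay hi) i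
  have h2 := abs_sub_single_le (mem_rayNhd_of_mem_nearRay hj) i
  rw [Pi.single_eq_same] at h1
  rw [Pi.single_eq_of_ne hij] at h2
  linarith [(abs_le.1 h1).1, (abs_le.1 h2).2]

lemma card_nearRay (u : ℕ → EuclideanSpace ℝ (Fin d)) (m : ℕ) (j : Fin n) :
    (nearRay Δ v t (fun i : Fin m => u i) j).card =
      Set.ncard {ℓ : ℕ | ℓ < m ∧ u ℓ ∈ rayNhd Δ v t j} := by
  have h : {ℓ : ℕ | ℓ < m ∧ u ℓ ∈ rayNhd Δ v t j} =
      ((nearRay Δ v t (fun i : Fin m => u i) j).map Fin.valEmbedding : Finset ℕ) := by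
    ext ℓ
    simp only [nearRay, Finset.coe_map, Set.mem_image, Finset.mem_coe,
      Set.Finite.mem_toFinset, Set.mem_ofPred_eq, Fin.valEmbedding_apply]
    constructor
    · rintro ⟨h1, h2⟩
      exact ⟨⟨ℓ, h1⟩, h2, rfl⟩
    · rintro ⟨k, hk, rfl⟩
      exact ⟨k.2, hk⟩
  rw [h, Set.ncard_coe_finset, Finset.card_map]

/-- Every ray of the fan is approximated by a fraction of at least `2.5 n t + δ` of the
directions `u ℓ`. -/
structure IsGoodDesign (Δ : Set (Set (EuclideanSpace ℝ (Fin d))))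
    (v : Fin n → EuclideanSpace ℝ (Fin d)) (u : Fin m → EuclideanSpace ℝ (Fin d)) (t δ : ℝ) :
    Prop where
  isFan : IsSimplicialPolytopalFan Δ v
  norm_eq_one : ∀ ℓ, ‖u ℓ‖ = 1
  size_pos : 0 < m
  nonneg : 0 ≤ t
  lt_half : t < 1 / 2
  pos : 0 < δ
  le_card : ∀ j, (m : ℝ) * (2.5 * n * t + δ) ≤ ((nearRay Δ v t u j).card : ℝ)

/-- The constant `δ / max_i ‖v_i‖²`. -/
noncomputable def gramConst (v : Fin n → EuclideanSpace ℝ (Fin d)) (δ : ℝ) : ℝ :=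
  δ / ⨆ i, ‖v i‖ ^ 2

lemma norm_sq_le_iSup (v : Fin n → EuclideanSpace ℝ (Fin d)) (j : Fin n) :
    ‖v j‖ ^ 2 ≤ ⨆ i, ‖v i‖ ^ 2 :=
  le_ciSup (Set.finite_range fun i => ‖v i‖ ^ 2).bddAbove j

namespace IsGoodDesign

variable (h : IsGoodDesign Δ v u t δ)

include h

/-- A single generator cannot represent both x and -x with non-negative coefficients when x ≠ 0. -/
lemma two_le : 2 ≤ n := by
  have hx := h.norm_eq_one ⟨0, h.size_pos⟩
  set x := u ⟨0, h.size_pos⟩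
  have hx0 : x ≠ 0 := by
    rintro h0
    simp [h0] at hx
  by_contra hn
  interval_cases n
  · have h1 := h.isFan.sum_fanCoord_smul x
    rw [Fin.sum_univ_zero] at h1
    exact hx0 h1.symm
  · have h1 := h.isFan.sum_fanCoord_smul x
    have h2 := h.isFan.sum_fanCoord_smul (-x)
    rw [Fin.sum_univ_one] at h1 h2
    have h3 : (fanCoord Δ v x 0 + fanCoord Δ v (-x) 0) • v 0 = 0 := by
      rw [add_smul, h1, h2, add_neg_cancel]
    have h4 := (smul_eq_zero.1 h3).resolve_right (h.isFan.generator_ne_zero 0)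
    have h5 : fanCoord Δ v x 0 = 0 := by
      linarith [h.isFan.fanCoord_nonneg x 0, h.isFan.fanCoord_nonneg (-x) 0]
    rw [h5, zero_smul] at h1
    exact hx0 h1.symm

lemma nonempty : Nonempty (Fin n) := ⟨⟨0, by have := h.two_le; omega⟩⟩

lemma dim_pos : 0 < d := by
  have hx := h.norm_eq_one ⟨0, h.size_pos⟩
  rcases Nat.eq_zero_or_pos d with rfl | hd
  · rw [Subsingleton.elim (u ⟨0, h.size_pos⟩) 0, norm_zero] at hx
    exact absurd hx zero_ne_one
  · exact hd

lemma mul_le_one : n * (2.5 * n * t + δ) ≤ 1 := by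
  have hm : (0 : ℝ) < m := by exact_mod_cast h.size_pos
  have h1 : ∑ j, ((nearRay Δ v t u j).card : ℝ) ≤ m := by
    rw [← Nat.cast_sum, ← Finset.card_biUnion
      fun i _ j _ hij => pairwise_disjoint_nearRay h.lt_half hij]
    exact_mod_cast (Finset.card_le_univ _).trans (by simp)
  have h2 := Finset.sum_le_sum fun j (_ : j ∈ Finset.univ) => h.le_card j
  rw [Finset.sum_const, Finset.card_univ, Fintype.card_fin, nsmul_eq_mul] at h2
  have h3 : m * (n * (2.5 * n * t + δ)) ≤ m * 1 := by linarith
  exact le_of_mul_le_mul_left h3 hm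

lemma iSup_pos : 0 < ⨆ i, ‖v i‖ ^ 2 := by
  obtain ⟨j⟩ := h.nonempty
  have hj := norm_pos_iff.2 (h.isFan.generator_ne_zero j)
  exact lt_of_lt_of_le (by positivity) (norm_sq_le_iSup v j)

lemma gramConst_pos : 0 < gramConst v δ := div_pos h.pos h.iSup_pos

lemma fanConst_pos : 0 < fanConst Δ v := by
  obtain ⟨j⟩ := h.nonempty
  have hj := norm_pos_iff.2 (h.isFan.generator_ne_zero j)
  exact lt_of_lt_of_le (by positivity) (h.isFan.inv_norm_le_fanConst j)

/-- Lets the stated threshold, with its power 3/2 in κ and its factor n c², dominate the one that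
the argument needs. -/
lemma gramConst_le : gramConst v δ ≤ n * fanConst Δ v ^ 2 := by
  obtain ⟨j⟩ := h.nonempty
  have hj := norm_pos_iff.2 (h.isFan.generator_ne_zero j)
  have h2 : (2 : ℝ) ≤ n := by exact_mod_cast h.two_le
  have hnt : 0 ≤ 2.5 * n * t := mul_nonneg (by positivity) h.nonneg
  have hδ : δ ≤ 1 := by nlinarith [h.mul_le_one, h.pos]
  have h3 : gramConst v δ ≤ (‖v j‖⁻¹) ^ 2 := by
    rw [gramConst, inv_pow, ← one_div]
    exact div_le_div₀ zero_le_one hδ (by positivity) (norm_sq_le_iSup v j)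
  have h4 := pow_le_pow_left₀ (by positivity) (h.isFan.inv_norm_le_fanConst j) 2
  nlinarith [sq_nonneg (fanConst Δ v)]

/-- Lower bound for the Gram matrix of the coordinate vectors. -/
lemma gram_lower_bound (b : Fin n → ℝ) :
    m * gramConst v δ * ∑ j, b j ^ 2 ≤ ∑ ℓ, interp Δ v b (u ℓ) ^ 2 := by
  have hv : ∀ j, 0 < ‖v j‖ := fun j => norm_pos_iff.2 (h.isFan.generator_ne_zero j)
  have hm : (0 : ℝ) < m := by exact_mod_cast h.size_pos
  have h2 : (2 : ℝ) ≤ n := by exact_mod_cast h.two_le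
  have hnt : 0 ≤ n * t := mul_nonneg (by positivity) h.nonneg
  -- Neighbourhoods of rays are measured in the coordinates [x]_k‖v_k‖, so the vector is rescaled to
  -- b_k/‖v_k‖.
  have hkey := mul_sum_sq_le_of_rows_near_basis (fun ℓ k => fanCoord Δ v (u ℓ) k * ‖v k‖)
    (nearRay Δ v t u) (pairwise_disjoint_nearRay h.lt_half)
    (fun j ℓ hℓ k => abs_sub_single_le (mem_rayNhd_of_mem_nearRay hℓ) k)
    (mul_nonneg hm.le (by nlinarith [h.pos])) h.nonneg h.le_card (fun j => b j / ‖v j‖)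
  have hsimp : ∀ ℓ, ∑ k, fanCoord Δ v (u ℓ) k * ‖v k‖ * (b k / ‖v k‖) = interp Δ v b (u ℓ) := by
    intro ℓ
    refine Finset.sum_congr rfl fun k _ => ?_
    have := (hv k).ne'
    field_simp
  simp only [hsimp] at hkey
  refine le_trans ?_ hkey
  -- With p = 2.5nt + δ, the right side is δ + nt(2.5 - 2p), and 2p ≤ np ≤ 1.
  have hδ : δ ≤ (2.5 * n * t + δ) * (1 - 2 * t * n) := by
    have h1 : 2 * (2.5 * n * t + δ) ≤ 1 := by
      have : 0 ≤ 2.5 * n * t + δ := by nlinarith [h.pos]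
      nlinarith [h.mul_le_one]
    nlinarith [mul_nonneg hnt (sub_nonneg.2 h1)]
  have hterm : ∀ j, (⨆ i, ‖v i‖ ^ 2)⁻¹ * b j ^ 2 ≤ (b j / ‖v j‖) ^ 2 := by
    intro j
    rw [div_pow, div_eq_inv_mul]
    exact mul_le_mul_of_nonneg_right (inv_anti₀ (pow_pos (hv j) 2) (norm_sq_le_iSup v j))
      (sq_nonneg _)
  calc m * gramConst v δ * ∑ j, b j ^ 2 = m * δ * ∑ j, (⨆ i, ‖v i‖ ^ 2)⁻¹ * b j ^ 2 := by
        rw [← Finset.mul_sum, gramConst, div_eq_mul_inv]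
        ring
    _ ≤ m * δ * ∑ j, (b j / ‖v j‖) ^ 2 :=
        mul_le_mul_of_nonneg_left (Finset.sum_le_sum fun j _ => hterm j)
          (mul_nonneg hm.le h.pos.le)
    _ ≤ _ := by
        refine mul_le_mul_of_nonneg_right ?_ (Finset.sum_nonneg fun _ _ => sq_nonneg _)
        rw [mul_assoc]
        exact mul_le_mul_of_nonneg_left hδ hm.le

lemma div_iInf_le (j : Fin n) : t ^ 2 / ‖v j‖ ^ 2 ≤ t ^ 2 / ⨅ i, ‖v i‖ ^ 2 := by
  have := h.nonempty
  obtain ⟨i, hi⟩ := exists_eq_ciInf_of_finite (f := fun i => ‖v i‖ ^ 2)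
  have hv := norm_pos_iff.2 (h.isFan.generator_ne_zero i)
  refine div_le_div_of_nonneg_left (sq_nonneg t) ?_
    (ciInf_le (Set.finite_range fun i => ‖v i‖ ^ 2).bddBelow j)
  rw [← hi]
  positivity

lemma div_iInf_le_fanConst_sq : t ^ 2 / ⨅ i, ‖v i‖ ^ 2 ≤ fanConst Δ v ^ 2 := by
  have := h.nonempty
  obtain ⟨i, hi⟩ := exists_eq_ciInf_of_finite (f := fun i => ‖v i‖ ^ 2)
  have hv := norm_pos_iff.2 (h.isFan.generator_ne_zero i)
  have h1 := pow_le_pow_left₀ (by positivity) (h.isFan.inv_norm_le_fanConst i) 2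
  have ht : t ^ 2 ≤ 1 := by nlinarith [h.nonneg, h.lt_half]
  rw [← hi]
  refine le_trans ?_ h1
  rw [inv_pow, ← one_div]
  exact div_le_div_of_nonneg_right ht (by positivity)

/-- Directions near one of the other n - 1 rays have j-th coordinate at most t/‖v_j‖; the rest are
bounded by c. This is where λ originates. -/
lemma sum_fanCoord_sq_le (j : Fin n) :
    ∑ ℓ, fanCoord Δ v (u ℓ) j ^ 2 ≤ m * lam Δ v t δ := by
  set τ := t ^ 2 / ⨅ i, ‖v i‖ ^ 2 with hτ
  set T := (Finset.univ.erase j).biUnion (nearRay Δ v t u) with hT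
  have hτc : τ ≤ fanConst Δ v ^ 2 := h.div_iInf_le_fanConst_sq
  have hle : ∀ ℓ, fanCoord Δ v (u ℓ) j ^ 2 ≤
      fanConst Δ v ^ 2 - if ℓ ∈ T then fanConst Δ v ^ 2 - τ else 0 := by
    intro ℓ
    split_ifs with hℓ
    · obtain ⟨i, hi, hℓi⟩ := Finset.mem_biUnion.1 hℓ
      have h1 := abs_sub_single_le (mem_rayNhd_of_mem_nearRay hℓi) j
      have hv := norm_pos_iff.2 (h.isFan.generator_ne_zero j)
      rw [Pi.single_eq_of_ne (Finset.ne_of_mem_erase hi).symm, sub_zero] at h1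
      have h2 : (fanCoord Δ v (u ℓ) j * ‖v j‖) ^ 2 ≤ t ^ 2 := sq_le_sq' (abs_le.1 h1).1 (abs_le.1 h1).2
      have h3 : fanCoord Δ v (u ℓ) j ^ 2 ≤ t ^ 2 / ‖v j‖ ^ 2 := by
        rw [le_div_iff₀ (by positivity), ← mul_pow]
        exact h2
      rw [sub_sub_cancel]
      exact h3.trans (h.div_iInf_le j)
    · rw [sub_zero]
      exact pow_le_pow_left₀ (h.isFan.fanCoord_nonneg _ j)
        (h.isFan.fanCoord_le_fanConst (h.norm_eq_one ℓ) j) 2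
  have hcard : ((n : ℝ) - 1) * (m * (2.5 * n * t + δ)) ≤ T.card := by
    rw [hT, Finset.card_biUnion fun i _ k _ hik => pairwise_disjoint_nearRay h.lt_half hik]
    push_cast
    refine le_trans (le_of_eq ?_) (Finset.sum_le_sum fun i (_ : i ∈ Finset.univ.erase j) =>
      h.le_card i)
    rw [Finset.sum_const, Finset.card_erase_of_mem (Finset.mem_univ j), Finset.card_univ,
      Fintype.card_fin, nsmul_eq_mul, Nat.cast_sub (by have := h.two_le; omega), Nat.cast_one]
  calc ∑ ℓ, fanCoord Δ v (u ℓ) j ^ 2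
      ≤ ∑ ℓ, (fanConst Δ v ^ 2 - if ℓ ∈ T then fanConst Δ v ^ 2 - τ else 0) :=
        Finset.sum_le_sum fun ℓ _ => hle ℓ
    _ = m * fanConst Δ v ^ 2 - T.card * (fanConst Δ v ^ 2 - τ) := by
        rw [Finset.sum_sub_distrib, Finset.sum_ite_mem]
        simp [mul_sub]
    _ ≤ m * fanConst Δ v ^ 2 -
          ((n : ℝ) - 1) * (m * (2.5 * n * t + δ)) * (fanConst Δ v ^ 2 - τ) :=
        sub_le_sub_left (mul_le_mul_of_nonneg_right hcard (sub_nonneg.2 hτc)) _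
    _ = m * lam Δ v t δ := by
        rw [lam]
        ring

/-- The j-th column of the design has positive norm by the Gram bound, and its square is at most mλ.
-/
lemma lam_pos : 0 < lam Δ v t δ := by
  have hm : (0 : ℝ) < m := by exact_mod_cast h.size_pos
  obtain ⟨j⟩ := h.nonempty
  have h1 := h.sum_fanCoord_sq_le j
  have h2 := h.gram_lower_bound (Pi.single j 1)
  have h3 : ∀ ℓ, interp Δ v (Pi.single j 1) (u ℓ) = fanCoord Δ v (u ℓ) j := by
    simp [interp, Pi.single_apply]
  simp only [h3] at h2
  have h4 : ∑ k, (Pi.single j 1 : Fin n → ℝ) k ^ 2 = 1 := by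
    simp [Pi.single_apply]
  rw [h4, mul_one] at h2
  have h5 : 0 < m * gramConst v δ := mul_pos hm h.gramConst_pos
  exact pos_of_mul_pos_right (lt_of_lt_of_le h5 (h2.trans h1)) hm.le

end IsGoodDesign

end Design

/-! ### Least squares as metric projection, and its error. -/

section LeastSquares

variable {Δ : Set (Set (EuclideanSpace ℝ (Fin d)))} {v : Fin n → EuclideanSpace ℝ (Fin d)}
  {m : ℕ} {u : Fin m → EuclideanSpace ℝ (Fin d)} {t δ : ℝ} {y : Fin m → ℝ}
  {P Q : Set (EuclideanSpace ℝ (Fin d))}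

/-- The values at the directions `u ℓ` as a linear function of the values at the ray
generators. -/
noncomputable def designMap (Δ : Set (Set (EuclideanSpace ℝ (Fin d))))
    (v : Fin n → EuclideanSpace ℝ (Fin d)) (u : Fin m → EuclideanSpace ℝ (Fin d)) :
    (Fin n → ℝ) →ₗ[ℝ] EuclideanSpace ℝ (Fin m) where
  toFun b := WithLp.toLp 2 fun ℓ => interp Δ v b (u ℓ)
  map_add' a b := by
    ext ℓ
    simp [interp, mul_add, Finset.sum_add_distrib]
  map_smul' r b := by
    ext ℓ
    simp only [interp, Pi.smul_apply, smul_eq_mul, RingHom.id_apply, PiLp.smul_apply,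
      Finset.mul_sum]
    exact Finset.sum_congr rfl fun _ _ => by ring

lemma designMap_apply (b : Fin n → ℝ) (ℓ : Fin m) :
    designMap Δ v u b ℓ = interp Δ v b (u ℓ) := rfl

lemma norm_designMap_sq (b : Fin n → ℝ) :
    ‖designMap Δ v u b‖ ^ 2 = ∑ ℓ, interp Δ v b (u ℓ) ^ 2 := by
  rw [EuclideanSpace.real_norm_sq_eq]
  rfl

lemma IsSimplicialPolytopalFan.meanSqError_eq (hΔ : IsSimplicialPolytopalFan Δ v)
    (hQ : Q ∈ deformationCone Δ) : meanSqError u y Q =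
      1 / (m : ℝ) * ‖WithLp.toLp 2 y - designMap Δ v u (supportVec v Q)‖ ^ 2 := by
  rw [meanSqError, EuclideanSpace.real_norm_sq_eq]
  congr 1
  refine Finset.sum_congr rfl fun ℓ _ => ?_
  rw [hΔ.supportFun_eq hQ, PiLp.sub_apply, designMap_apply]
  ring

namespace IsGoodDesign

variable (h : IsGoodDesign Δ v u t δ)

include h

lemma ker_designMap : (designMap Δ v u).ker = ⊥ := by
  refine LinearMap.ker_eq_bot'.2 fun b hb => ?_
  have hm : (0 : ℝ) < m := by exact_mod_cast h.size_pos
  have h1 := h.gram_lower_bound b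
  rw [← norm_designMap_sq, hb, norm_zero, zero_pow two_ne_zero] at h1
  have h2 : 0 < m * gramConst v δ := mul_pos hm h.gramConst_pos
  have h3 : ∑ j, b j ^ 2 ≤ 0 := nonpos_of_mul_nonpos_right h1 h2
  have h4 := (Finset.sum_eq_zero_iff_of_nonneg fun j _ => sq_nonneg (b j)).1
    (le_antisymm h3 (Finset.sum_nonneg fun j _ => sq_nonneg (b j)))
  ext j
  exact pow_eq_zero_iff two_ne_zero |>.1 (h4 j (Finset.mem_univ j))

/-- Least-squares estimates are the metric projections of the data. -/
lemma mem_leastSquares_iff : Q ∈ leastSquares Δ u y ↔ Q ∈ deformationCone Δ ∧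
    ∀ b ∈ subadditiveVectors Δ v,
      inner ℝ (WithLp.toLp 2 y - designMap Δ v u (supportVec v Q))
        (designMap Δ v u b - designMap Δ v u (supportVec v Q)) ≤ 0 := by
  have hm : (0 : ℝ) < m := by exact_mod_cast h.size_pos
  refine and_congr_right fun hQ => ?_
  have hconv := (convex_subadditiveVectors (Δ := Δ) (v := v)).linear_image (designMap Δ v u)
  have hmem := Set.mem_image_of_mem (designMap Δ v u) (h.isFan.supportVec_mem hQ)
  have hproj := norm_eq_iInf_iff_real_inner_le_zero hconv (u := WithLp.toLp 2 y) hmem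
  rw [Set.forall_mem_image] at hproj
  rw [← hproj]
  have hbdd : BddBelow (Set.range fun w : designMap Δ v u '' subadditiveVectors Δ v =>
      ‖WithLp.toLp 2 y - (w : EuclideanSpace ℝ (Fin m))‖) :=
    ⟨0, by rintro _ ⟨w, rfl⟩; exact norm_nonneg _⟩
  constructor
  · intro hmin
    have : Nonempty (designMap Δ v u '' subadditiveVectors Δ v) := ⟨⟨_, hmem⟩⟩
    refine le_antisymm (le_ciInf ?_) (ciInf_le hbdd ⟨_, hmem⟩)
    rintro ⟨_, b, hb, rfl⟩
    have h1 := hmin _ (h.isFan.polyhedronOf_mem hb)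
    rw [h.isFan.meanSqError_eq hQ, h.isFan.meanSqError_eq (h.isFan.polyhedronOf_mem hb),
      h.isFan.supportVec_polyhedronOf hb] at h1
    exact le_of_sq_le_sq (le_of_mul_le_mul_left h1 (by positivity)) (norm_nonneg _)
  · intro hinf R hR
    rw [h.isFan.meanSqError_eq hQ, h.isFan.meanSqError_eq hR, hinf]
    refine mul_le_mul_of_nonneg_left (pow_le_pow_left₀ ?_ ?_ 2) (by positivity)
    · rw [← hinf]
      exact norm_nonneg _
    · exact ciInf_le hbdd ⟨_, Set.mem_image_of_mem _ (h.isFan.supportVec_mem hR)⟩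

/-- An injective linear map carries the closed convex set of admissible vectors to a closed convex
set, on which a nearest point exists. Adding the variational inequalities of two minimizers makes
their images equal; injectivity then identifies the vectors, and these the polytopes. -/
theorem existsUnique_leastSquares (y : Fin m → ℝ) : ∃! Q, Q ∈ leastSquares Δ u y := by
  have hconv := (convex_subadditiveVectors (Δ := Δ) (v := v)).linear_image (designMap Δ v u)
  have hclosed : IsClosed (designMap Δ v u '' subadditiveVectors Δ v) :=
    (LinearMap.isClosedEmbedding_of_injective h.ker_designMap).isClosedMap _
      isClosed_subadditiveVectors
  have hne : (designMap Δ v u '' subadditiveVectors Δ v).Nonempty :=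
    ⟨_, 0, fun x y => by simp [interp], rfl⟩
  obtain ⟨_, ⟨b, hb, rfl⟩, hproj⟩ := exists_norm_eq_iInf_of_complete_convex hne
    hclosed.isComplete hconv (WithLp.toLp 2 y)
  rw [norm_eq_iInf_iff_real_inner_le_zero hconv (Set.mem_image_of_mem _ hb),
    Set.forall_mem_image] at hproj
  refine ⟨polyhedronOf v b, h.mem_leastSquares_iff.2 ⟨h.isFan.polyhedronOf_mem hb, ?_⟩, ?_⟩
  · rwa [h.isFan.supportVec_polyhedronOf hb]
  · intro Q hQ
    obtain ⟨hQ, hQproj⟩ := h.mem_leastSquares_iff.1 hQ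
    have h1 := hQproj b hb
    have h2 := hproj (h.isFan.supportVec_mem hQ)
    have h3 : inner ℝ (designMap Δ v u b - designMap Δ v u (supportVec v Q))
        (designMap Δ v u b - designMap Δ v u (supportVec v Q)) ≤ 0 := by
      have e : inner ℝ (designMap Δ v u b - designMap Δ v u (supportVec v Q))
          (designMap Δ v u b - designMap Δ v u (supportVec v Q)) =
          inner ℝ (WithLp.toLp 2 y - designMap Δ v u (supportVec v Q))
            (designMap Δ v u b - designMap Δ v u (supportVec v Q)) +
          inner ℝ (WithLp.toLp 2 y - designMap Δ v u b)
            (designMap Δ v u (supportVec v Q) - designMap Δ v u b) := by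
        simp only [inner_sub_left, inner_sub_right]
        ring
      rw [e]
      exact add_nonpos h1 h2
    have h4 := sub_eq_zero.1 (real_inner_self_nonpos.1 h3)
    have h5 : b = supportVec v Q := LinearMap.ker_eq_bot.1 h.ker_designMap h4
    rw [h5]
    exact h.isFan.eq_polyhedronOf hQ

/-- The estimation error is controlled by the projections of the noise to the columns of the
design. -/
theorem hausdorffDist_leastSquares_le {e : Fin m → ℝ} (hP : P ∈ deformationCone Δ)
    (hQ : Q ∈ leastSquares Δ u (fun ℓ => supportFun P (u ℓ) + e ℓ)) :
    (m * gramConst v δ * Metric.hausdorffDist Q P) ^ 2 ≤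
      d * fanConst Δ v ^ 2 * ∑ i, (∑ ℓ, fanCoord Δ v (u ℓ) i * e ℓ) ^ 2 := by
  obtain ⟨hQ, hproj⟩ := h.mem_leastSquares_iff.1 hQ
  have hm : (0 : ℝ) < m := by exact_mod_cast h.size_pos
  have hα : 0 < m * gramConst v δ := mul_pos hm h.gramConst_pos
  set z : Fin n → ℝ := supportVec v Q - supportVec v P with hz
  set Z : Fin n → ℝ := fun i => ∑ ℓ, fanCoord Δ v (u ℓ) i * e ℓ with hZ
  have h1 := hproj _ (h.isFan.supportVec_mem hP)
  -- The variational inequality is tested with the true polytope P.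
  have h2 : ‖designMap Δ v u z‖ ^ 2 ≤ ∑ i, z i * Z i := by
    have e1 : WithLp.toLp 2 (fun ℓ => supportFun P (u ℓ) + e ℓ) -
        designMap Δ v u (supportVec v Q) = WithLp.toLp 2 e - designMap Δ v u z := by
      ext ℓ
      simp only [PiLp.sub_apply, designMap_apply, hz, interp_sub, h.isFan.supportFun_eq hP]
      ring
    have e2 : designMap Δ v u (supportVec v P) - designMap Δ v u (supportVec v Q) =
        -designMap Δ v u z := by
      rw [hz, map_sub, neg_sub]
    have e3 : inner ℝ (WithLp.toLp 2 e) (designMap Δ v u z) = ∑ i, z i * Z i := by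
      simp only [PiLp.inner_apply, designMap_apply, interp, hZ, Finset.mul_sum]
      rw [Finset.sum_comm]
      simp only [RCLike.inner_apply, conj_trivial, Finset.sum_mul]
      exact Finset.sum_congr rfl fun ℓ _ => Finset.sum_congr rfl fun i _ => by ring
    rw [e1, e2, inner_neg_right, inner_sub_left, real_inner_self_eq_norm_sq, e3] at h1
    linarith
  have h3 := h.gram_lower_bound z
  rw [← norm_designMap_sq] at h3
  set S := ∑ i, z i ^ 2 with hS
  have hS0 : 0 ≤ S := Finset.sum_nonneg fun _ _ => sq_nonneg _
  -- Squaring mα‖z‖² ≤ ⟨z, Z⟩ and applying Cauchy–Schwarz leaves a factor ‖z‖² to cancel, so z = 0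
  -- is treated apart.
  have h4 : (m * gramConst v δ) ^ 2 * S ≤ ∑ i, Z i ^ 2 := by
    have h5 := Finset.sum_mul_sq_le_sq_mul_sq Finset.univ z Z
    have h6 := pow_le_pow_left₀ (mul_nonneg hα.le hS0) (h3.trans h2) 2
    rcases hS0.eq_or_lt with h0 | h0
    · rw [← h0, mul_zero]
      exact Finset.sum_nonneg fun _ _ => sq_nonneg _
    · refine le_of_mul_le_mul_left ?_ h0
      nlinarith
  have h7 : Metric.hausdorffDist Q P ^ 2 ≤ d * fanConst Δ v ^ 2 * S := by
    have h8 := pow_le_pow_left₀ Metric.hausdorffDist_nonneg (h.isFan.hausdorffDist_le hQ hP) 2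
    rwa [Real.sq_sqrt (by positivity)] at h8
  calc (m * gramConst v δ * Metric.hausdorffDist Q P) ^ 2
      = (m * gramConst v δ) ^ 2 * Metric.hausdorffDist Q P ^ 2 := by ring
    _ ≤ (m * gramConst v δ) ^ 2 * (d * fanConst Δ v ^ 2 * S) :=
        mul_le_mul_of_nonneg_left h7 (sq_nonneg _)
    _ = d * fanConst Δ v ^ 2 * ((m * gramConst v δ) ^ 2 * S) := by ring
    _ ≤ _ := mul_le_mul_of_nonneg_left h4 (by positivity)

end IsGoodDesign

end LeastSquares

/-! ### Sub-Gaussian tails of weighted noise. -/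

section Noise

variable {Ω : Type*} [MeasurableSpace Ω] {μ : Measure Ω}

lemma hasSubgaussianMGF_mono {X : Ω → ℝ} {a b : NNReal} (h : HasSubgaussianMGF X a μ)
    (hab : a ≤ b) : HasSubgaussianMGF X b μ where
  integrable_exp_mul := h.integrable_exp_mul
  mgf_le s := (h.mgf_le s).trans (Real.exp_le_exp.2 (by
    have : (a : ℝ) ≤ b := hab
    gcongr))

lemma hasSubgaussianMGF_of_map_eq_gaussianReal {X : Ω → ℝ} (hX : Measurable X) {a : NNReal}
    (h : μ.map X = gaussianReal 0 a) : HasSubgaussianMGF X a μ where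
  integrable_exp_mul s := by
    have h1 : Integrable (fun x => Real.exp (s * x)) (μ.map X) := by
      rw [h]
      exact integrable_exp_mul_gaussianReal s
    exact h1.comp_measurable hX
  mgf_le s := by
    rw [mgf_gaussianReal h, zero_mul, zero_add]

/-- Tail bound for weighted sums of independent centred Gaussians with bounded variances. -/
lemma measure_le_abs_sum_le {ι : Type*} [Fintype ι] {ε : ι → Ω → ℝ} (hmeas : ∀ ℓ, Measurable (ε ℓ))
    {s : ι → NNReal} (hlaw : ∀ ℓ, μ.map (ε ℓ) = gaussianReal 0 (s ℓ)) (hindep : iIndepFun ε μ)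
    {γ : ℝ} (hs : ∀ ℓ, (s ℓ : ℝ) ≤ γ) (a : ι → ℝ) {W r : ℝ} (hW : γ * ∑ ℓ, a ℓ ^ 2 ≤ W)
    (hW0 : 0 ≤ W) (hr : 0 ≤ r) :
    μ {ω | r ≤ |∑ ℓ, a ℓ * ε ℓ ω|} ≤ ENNReal.ofReal (2 * Real.exp (-r ^ 2 / (2 * W))) := by
  have := hindep.isProbabilityMeasure
  have hterm : ∀ ℓ, HasSubgaussianMGF (fun ω => a ℓ * ε ℓ ω) (‖a ℓ‖₊ ^ 2 * s ℓ) μ := fun ℓ =>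
    hasSubgaussianMGF_mono
      ((hasSubgaussianMGF_of_map_eq_gaussianReal (hmeas ℓ) (hlaw ℓ)).const_mul (a ℓ)) (by
        refine mul_le_mul_left (NNReal.coe_le_coe.1 ?_) _
        rw [NNReal.coe_pow, coe_nnnorm, Real.norm_eq_abs, sq_abs]
        exact le_rfl)
  have hind : iIndepFun (fun ℓ ω => a ℓ * ε ℓ ω) μ :=
    hindep.comp (fun ℓ x => a ℓ * x) fun ℓ => measurable_const_mul (a ℓ)
  have hle : ∑ ℓ, ‖a ℓ‖₊ ^ 2 * s ℓ ≤ W.toNNReal := by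
    refine (Real.le_toNNReal_iff_coe_le hW0).2 (le_trans ?_ hW)
    push_cast
    rw [Finset.mul_sum]
    exact Finset.sum_le_sum fun ℓ _ => by
      rw [mul_comm, Real.norm_eq_abs, sq_abs]
      exact mul_le_mul_of_nonneg_right (hs ℓ) (sq_nonneg _)
  have hsum := hasSubgaussianMGF_mono
    (HasSubgaussianMGF.sum_of_iIndepFun hind (s := Finset.univ) fun ℓ _ => hterm ℓ) hle
  have h1 := hsum.measure_ge_le hr
  have h2 := hsum.neg.measure_ge_le hr
  rw [Real.coe_toNNReal W hW0] at h1 h2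
  have hsub : {ω | r ≤ |∑ ℓ, a ℓ * ε ℓ ω|} ⊆ {ω | r ≤ ∑ ℓ, a ℓ * ε ℓ ω} ∪
      {ω | r ≤ (-fun ω => ∑ ℓ, a ℓ * ε ℓ ω) ω} := by
    intro ω hω
    simp only [Set.mem_union, Set.mem_ofPred_eq, Pi.neg_apply] at hω ⊢
    exact le_abs.1 hω
  rw [← ofReal_measureReal]
  refine ENNReal.ofReal_le_ofReal ?_
  refine (measureReal_mono hsub).trans ((measureReal_union_le _ _).trans ?_)
  rw [two_mul]
  exact add_le_add h1 h2

end Noise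

/-! ### Decay of the error threshold. -/

section Convergence

/-- The squared expression is a multiple of log b/m + 2 log(m + 1)/m. It is the threshold obtained
for η = 1/(m + 1)². -/
lemma tendsto_sqrt_log_div_atTop (a b : ℝ) (hb : 0 < b) :
    Tendsto (fun m : ℕ => 1 / √(m : ℝ) * √(a * Real.log (b * ((m : ℝ) + 1) ^ 2))) atTop (𝓝 0) := by
  have hlog : Tendsto (fun x : ℝ => Real.log (x + 1) / x) atTop (𝓝 0) := by
    have h1 : Tendsto (fun x : ℝ => Real.log (x + 1) / (x + 1)) atTop (𝓝 0) :=
      (Real.isLittleO_log_id_atTop.tendsto_div_nhds_zero).comp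
        (tendsto_atTop_add_const_right _ 1 tendsto_id)
    have h2 : Tendsto (fun x : ℝ => 1 + x⁻¹) atTop (𝓝 (1 + 0)) :=
      tendsto_const_nhds.add tendsto_inv_atTop_zero
    have h3 := h1.mul h2
    rw [zero_mul] at h3
    refine h3.congr' ?_
    filter_upwards [eventually_gt_atTop 0] with x hx
    field_simp
  have h4 : Tendsto (fun m : ℕ => a * (Real.log b * (m : ℝ)⁻¹ +
      2 * (Real.log ((m : ℝ) + 1) / m))) atTop (𝓝 (a * (Real.log b * 0 + 2 * 0))) :=
    (((tendsto_inv_atTop_zero.const_mul _).add (hlog.const_mul 2)).const_mul a).comp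
      tendsto_natCast_atTop_atTop
  have h5 := (Real.continuous_sqrt.tendsto _).comp h4
  simp only [mul_zero, add_zero, Real.sqrt_zero] at h5
  refine h5.congr fun m => ?_
  rw [Function.comp_apply, one_div, ← Real.sqrt_inv, ← Real.sqrt_mul (by positivity)]
  congr 1
  rw [Real.log_mul hb.ne' (by positivity), Real.log_pow]
  push_cast
  ring

end Convergence

/-! ### From noise tails to the deviation bound. -/

section Estimation

variable {Δ : Set (Set (EuclideanSpace ℝ (Fin d)))} {v : Fin n → EuclideanSpace ℝ (Fin d)}
  {m : ℕ} {u : Fin m → EuclideanSpace ℝ (Fin d)} {t δ : ℝ}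

namespace IsGoodDesign

variable (h : IsGoodDesign Δ v u t δ)

include h

lemma kappa_pos : 0 < kappa v δ := Real.rpow_pos_of_pos h.gramConst_pos _

lemma kappa_sq : kappa v δ ^ 2 = gramConst v δ ^ 3 := by
  rw [kappa, ← gramConst, ← Real.rpow_natCast, ← Real.rpow_mul h.gramConst_pos.le,
    ← Real.rpow_natCast]
  norm_num

/-- If the estimation error is large, the noise has a large projection to some column of the
design. -/
lemma exists_le_abs_of_le_hausdorffDist {P Q : Set (EuclideanSpace ℝ (Fin d))} {e : Fin m → ℝ}
    (hP : P ∈ deformationCone Δ)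
    (hQ : Q ∈ leastSquares Δ u (fun ℓ => supportFun P (u ℓ) + e ℓ)) {γ L : ℝ} (hγ : 0 ≤ γ)
    (hL : 0 ≤ L)
    (hthr : 1 / √(m : ℝ) * (n * fanConst Δ v ^ 2 / kappa v δ) *
      √(2 * d * γ * lam Δ v t δ * L) ≤ Metric.hausdorffDist Q P) :
    ∃ i, √(2 * (γ * (m * lam Δ v t δ)) * L) ≤ |∑ ℓ, fanCoord Δ v (u ℓ) i * e ℓ| := by
  have hm : (0 : ℝ) < m := by exact_mod_cast h.size_pos
  have hn : (0 : ℝ) < n := by exact_mod_cast lt_of_lt_of_le two_pos h.two_le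
  have hd : (0 : ℝ) < d := by exact_mod_cast h.dim_pos
  have hc := h.fanConst_pos
  have hα := h.gramConst_pos
  have hκ := h.kappa_pos
  have hlam := h.lam_pos
  set c := fanConst Δ v
  set lm := lam Δ v t δ
  set α := gramConst v δ with hα_def
  set κ := kappa v δ with hκ_def
  have hdist := h.hausdorffDist_leastSquares_le hP hQ
  have hsq := pow_le_pow_left₀ (by positivity) hthr 2
  rw [mul_pow, Real.sq_sqrt (by positivity), mul_pow, div_pow, one_pow, Real.sq_sqrt hm.le,
    div_pow, h.kappa_sq, ← hα_def] at hsq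
  have hlow : n * (2 * (γ * (m * lm)) * L) ≤ ∑ i, (∑ ℓ, fanCoord Δ v (u ℓ) i * e ℓ) ^ 2 := by
    have hdc : 0 < d * c ^ 2 := by positivity
    refine le_of_mul_le_mul_left ?_ hdc
    refine le_trans ?_ hdist
    rw [mul_pow]
    refine le_trans ?_ (mul_le_mul_of_nonneg_left hsq (sq_nonneg _))
    -- The surplus n c²/α of the stated threshold is at least 1 and is dropped.
    have e1 : (m * α) ^ 2 * (1 / m * ((n * c ^ 2) ^ 2 / α ^ 3) * (2 * d * γ * lm * L)) =
        (n * c ^ 2 / α) * (d * c ^ 2 * (n * (2 * (γ * (m * lm)) * L))) := by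
      field_simp
    rw [e1]
    refine le_mul_of_one_le_left (by positivity) ?_
    rw [one_le_div hα]
    exact h.gramConst_le
  have hne := h.nonempty
  -- A sum of n terms bounded below by n times a number has a term at least that number.
  obtain ⟨i, -, hi⟩ : ∃ i ∈ (Finset.univ : Finset (Fin n)), 2 * (γ * (m * lm)) * L ≤
      (∑ ℓ, fanCoord Δ v (u ℓ) i * e ℓ) ^ 2 := by
    refine Finset.exists_le_of_sum_le Finset.univ_nonempty ?_
    rwa [Finset.sum_const, Finset.card_univ, Fintype.card_fin, nsmul_eq_mul]
  exact ⟨i, Real.sqrt_le_iff.2 ⟨abs_nonneg _, by rwa [sq_abs]⟩⟩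

/-- Finite sample bound for the Hausdorff distance between least-squares estimate and truth. -/
theorem measure_le_hausdorffDist_le {P : Set (EuclideanSpace ℝ (Fin d))}
    (hP : P ∈ deformationCone Δ) {Ω : Type*} [MeasurableSpace Ω] {μ : Measure Ω}
    {ε : Fin m → Ω → ℝ} (hmeas : ∀ ℓ, Measurable (ε ℓ)) {s : Fin m → NNReal}
    (hlaw : ∀ ℓ, μ.map (ε ℓ) = gaussianReal 0 (s ℓ)) (hindep : iIndepFun ε μ)
    {γ : ℝ} (hγ : 0 < γ) (hs : ∀ ℓ, (s ℓ : ℝ) ≤ γ) {Phat : Ω → Set (EuclideanSpace ℝ (Fin d))}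
    (hPhat : ∀ ω, Phat ω ∈ leastSquares Δ u (fun ℓ => supportFun P (u ℓ) + ε ℓ ω))
    {η : ℝ} (hη0 : 0 < η) (hη1 : η ≤ 1) :
    μ {ω | 1 / √(m : ℝ) * (n * fanConst Δ v ^ 2 / kappa v δ) *
          √(2 * d * γ * lam Δ v t δ * Real.log (2 * n / η))
        ≤ Metric.hausdorffDist (Phat ω) P} ≤ ENNReal.ofReal η := by
  have hm : (0 : ℝ) < m := by exact_mod_cast h.size_pos
  have hn2 : (2 : ℝ) ≤ n := by exact_mod_cast h.two_le
  have hn : (0 : ℝ) < n := by linarith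
  have hlam := h.lam_pos
  have hL : 0 ≤ Real.log (2 * n / η) := by
    refine Real.log_nonneg ((one_le_div hη0).2 ?_)
    linarith
  set L := Real.log (2 * n / η) with hL_def
  set W := γ * (m * lam Δ v t δ) with hW_def
  have hW : 0 < W := by positivity
  have hsub : {ω | 1 / √(m : ℝ) * (n * fanConst Δ v ^ 2 / kappa v δ) *
      √(2 * d * γ * lam Δ v t δ * L) ≤ Metric.hausdorffDist (Phat ω) P} ⊆
      ⋃ i, {ω | √(2 * W * L) ≤ |∑ ℓ, fanCoord Δ v (u ℓ) i * ε ℓ ω|} := fun ω hω =>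
    Set.mem_iUnion.2 (h.exists_le_abs_of_le_hausdorffDist hP (hPhat ω) hγ.le hL hω)
  -- The level √(2WL) turns the tail 2 exp(-r²/(2W)) into 2 exp(-L) = η/n, leaving room for a union
  -- over n rays.
  have htail : ∀ i, μ {ω | √(2 * W * L) ≤ |∑ ℓ, fanCoord Δ v (u ℓ) i * ε ℓ ω|} ≤
      ENNReal.ofReal (η / n) := by
    intro i
    refine (measure_le_abs_sum_le hmeas hlaw hindep hs _
      (mul_le_mul_of_nonneg_left (h.sum_fanCoord_sq_le i) hγ.le) hW.le
      (Real.sqrt_nonneg _)).trans (le_of_eq ?_)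
    rw [← hW_def, Real.sq_sqrt (by positivity)]
    have e1 : -(2 * W * L) / (2 * W) = -L := by field_simp
    rw [e1, Real.exp_neg, hL_def, Real.exp_log (by positivity)]
    congr 1
    field_simp
  refine (measure_mono hsub).trans ((measure_iUnion_fintype_le μ _).trans
    ((Finset.sum_le_sum fun i _ => htail i).trans (le_of_eq ?_)))
  rw [Finset.sum_const, Finset.card_univ, Fintype.card_fin, nsmul_eq_mul, ← ENNReal.ofReal_natCast,
    ← ENNReal.ofReal_mul hn.le]
  congr 1
  field_simp

end IsGoodDesign

end Estimation

end SupportReconstruction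

/-! ### The theorem. -/

open SupportReconstruction in
theorem theorem4p2 {d n : ℕ}
    (Δ : Set (Set (EuclideanSpace ℝ (Fin d)))) (v : Fin n → EuclideanSpace ℝ (Fin d))
    (hΔ : IsSimplicialPolytopalFan Δ v)
    -- the directions; `u ℓ` is the `(ℓ + 1)`-st one
    (u : ℕ → EuclideanSpace ℝ (Fin d)) (hu : ∀ ℓ, ‖u ℓ‖ = 1)
    (t δ : ℝ) (ht0 : 0 ≤ t) (ht : t < 1 / 2) (hδ : 0 < δ) (N : ℕ) (hN : 1 ≤ N)
    (hcount : ∀ m ≥ N, ∀ i : Fin n,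
      (m : ℝ) * (2.5 * n * t + δ) ≤ (Set.ncard {ℓ : ℕ | ℓ < m ∧ u ℓ ∈ rayNhd Δ v t i} : ℝ))
    (P : Set (EuclideanSpace ℝ (Fin d))) (hP : P ∈ deformationCone Δ)
    {Ω : Type*} [MeasurableSpace Ω] (μ : Measure Ω) [IsProbabilityMeasure μ]
    (ε : ℕ → Ω → ℝ) (hmeas : ∀ ℓ, Measurable (ε ℓ))
    (s : ℕ → NNReal) (hlaw : ∀ ℓ, μ.map (ε ℓ) = gaussianReal 0 (s ℓ))
    (hindep : iIndepFun ε μ)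
    (γ : ℝ) (hγ : 0 < γ) (hs : ∀ ℓ, (s ℓ : ℝ) ≤ γ) :
    -- uniqueness, for every data vector
    (∀ m ≥ N, ∀ y : Fin m → ℝ, ∃! Q, Q ∈ leastSquares Δ (fun i : Fin m => u i) y) ∧
    -- `Phat m ω` is the estimate from the first `m` noisy support function evaluations of `P`
    ∀ Phat : ℕ → Ω → Set (EuclideanSpace ℝ (Fin d)),
      (∀ m ≥ N, ∀ ω, Phat m ω ∈ leastSquares Δ (fun i : Fin m => u i)
        (fun i : Fin m => supportFun P (u i) + ε i ω)) →
      (∀ᵐ ω ∂μ, Tendsto (fun m => Metric.hausdorffDist (Phat m ω) P) atTop (𝓝 0)) ∧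
      ∀ m ≥ N, ∀ η : ℝ, 0 < η → η ≤ 1 →
        μ {ω | 1 / √(m : ℝ) * (n * fanConst Δ v ^ 2 / kappa v δ) *
              √(2 * d * γ * lam Δ v t δ * Real.log (2 * n / η))
            ≤ Metric.hausdorffDist (Phat m ω) P} ≤ ENNReal.ofReal η := by
  have hgood : ∀ m ≥ N, IsGoodDesign Δ v (fun i : Fin m => u i) t δ := fun m hm =>
    ⟨hΔ, fun ℓ => hu ℓ, lt_of_lt_of_le hN hm, ht0, ht, hδ, fun j => by
      rw [card_nearRay]
      exact hcount m hm j⟩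
  refine ⟨fun m hm => (hgood m hm).existsUnique_leastSquares, fun Phat hPhat => ?_⟩
  have hbound : ∀ m ≥ N, ∀ η : ℝ, 0 < η → η ≤ 1 →
      μ {ω | 1 / √(m : ℝ) * (n * fanConst Δ v ^ 2 / kappa v δ) *
            √(2 * d * γ * lam Δ v t δ * Real.log (2 * n / η))
          ≤ Metric.hausdorffDist (Phat m ω) P} ≤ ENNReal.ofReal η := fun m hm η hη0 hη1 =>
    (hgood m hm).measure_le_hausdorffDist_le hP (fun ℓ => hmeas ℓ) (fun ℓ => hlaw ℓ)
      (hindep.precomp Fin.val_injective) hγ (fun ℓ => hs ℓ) (hPhat m hm) hη0 hη1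
  refine ⟨?_, hbound⟩
  have hn : 0 < n := lt_of_lt_of_le two_pos (hgood N le_rfl).two_le
  -- η = 1/(m + 1)² is summable, yet costs only a logarithm in the threshold.
  set thr : ℕ → ℝ := fun m => 1 / √(m : ℝ) * (n * fanConst Δ v ^ 2 / kappa v δ) *
    √(2 * d * γ * lam Δ v t δ * Real.log (2 * n / (1 / ((m : ℝ) + 1) ^ 2))) with hthr
  have hthr0 : Tendsto thr atTop (𝓝 0) := by
    have h1 := (tendsto_sqrt_log_div_atTop (2 * d * γ * lam Δ v t δ) (2 * n)
      (by positivity)).const_mul (n * fanConst Δ v ^ 2 / kappa v δ)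
    rw [mul_zero] at h1
    refine h1.congr fun m => ?_
    simp only [hthr, div_div_eq_mul_div, div_one]
    ring
  have hsummable : Summable fun k : ℕ => 1 / (((k + N : ℕ) : ℝ) + 1) ^ 2 := by
    have h1 := (summable_nat_add_iff (N + 1)).2 (Real.summable_one_div_nat_pow.2 one_lt_two)
    refine h1.congr fun k => ?_
    push_cast
    ring_nf
  -- Borel–Cantelli is applied to outer measures, so the estimates need not be measurable. The shift
  -- by N is there because they are constrained only from N on.
  have hBC := ae_eventually_notMem (μ := μ)
    (s := fun k => {ω | thr (k + N) ≤ Metric.hausdorffDist (Phat (k + N) ω) P})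
    (ne_top_of_le_ne_top hsummable.tsum_ofReal_ne_top (ENNReal.tsum_le_tsum fun k =>
      hbound (k + N) (Nat.le_add_left N k) _ (by positivity) (by
        rw [div_le_one (by positivity)]
        exact one_le_pow₀ (by linarith [Nat.cast_nonneg (α := ℝ) (k + N)]))))
  filter_upwards [hBC] with ω hω
  rw [← tendsto_add_atTop_iff_nat N]
  refine squeeze_zero' (Eventually.of_forall fun k => Metric.hausdorffDist_nonneg) ?_
    ((tendsto_add_atTop_iff_nat N).2 hthr0)
  exact hω.mono fun k hk => (not_le.1 hk).le
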